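/- There is an absolute constant $\underline{C}_{\mathrm{clip}}>0$ such that for every $c_R>0$ there is $\underline{c}>0$ (depending only on $c_R$) such that the following holds for all constants $c_0,c_1\ge \underline c$ with $c_1/c_0>4$ and all $C_{\mathrm{clip}}\ge \underline C_{\mathrm{clip}}$. There is a constant $C>0$, depending only on $c_R,c_0,c_1,C_{\mathrm{clip}}$ (and in particular not on the dimension $d$, the number of components $K$, or the number of steps $T$), such that for all $d, K\ge 1$ and $T\ge 2$: *Target.* Let $X_0\sim\sum_{k=1}^K\pi_k\,\mathcal N(\mu_k,I_d)$ on $\mathbb R^d$, where $\pi_k>0$, $\sum_k\pi_k=1$ and $\max_k\|\mu_k\|_2\le T^{c_R}$. *Learning rates.* Put $\overline\alpha_0=1$, $\overline\alpha_T=T^{-c_0}$, $\overline\alpha_{t-1}=\overline\alpha_t+c_1\frac{\log T}{T}\overline\alpha_t(1-\overline\alpha_t)$ for $t=T,\dots,2$, and $\alpha_t=\overline\alpha_t/\overline\alpha_{t-1}$ for $1\le t\le T$. *Forward process and scores.* Let $X_t=\sqrt{\alpha_t}\,X_{t-1}+\sqrt{1-\alpha_t}\,W_t$ for $1\le t\le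 T$, with $W_t\sim\mathcal N(0,I_d)$ i.i.d. and independent of $X_0$; let $p_{X_t}$ be the continuous density of $X_t$ and $s_t^\star=\nabla\log p_{X_t}$. Let $s_1,\dots,s_T:\mathbb R^d\to\mathbb R^d$ be measurable score estimates and $\varepsilon_{\mathrm{score}}\ge0$ be such that $$\frac1T\sum_{t=1}^T\mathbb E\big[\|s_t(X_t)-s_t^\star(X_t)\|_2^2\big]\le\varepsilon_{\mathrm{score}}^2 .$$ *DDPM sampler.* Let $\widehat s_t(x)=s_t(x)$ if $\|s_t(x)\|_2\le C_{\mathrm{clip}}\sqrt{d\log(dT)/(1-\overline\alpha_t)}$ and $\widehat s_t(x)=0$ otherwise. Start from $Y_T\sim\mathcal N(0,I_d)$ and let $$Y_{t-1}=\frac1{\sqrt{\alpha_t}}\big(Y_t+(1-\alpha_t)\widehat s_t(Y_t)\big)+\sqrt{1-\alpha_t}\,Z_t,\qquad t=T,\dots,2,$$ with $Z_t\sim\mathcal N(0,I_d)$ i.i.d. and independent of $Y_T$. Then the output $Y_1$ satisfies $$\mathsf{TV}(X_0,Y_1)\le C\left(\frac{\log^2(KT)\,\log^2T}{T}+\varepsilon_{\mathrm{score}}\sqrt{\log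 T}\right).$$ Here $\mathsf{TV}(X,Y)=\sup_A|\mathbb P(X\in A)-\mathbb P(Y\in A)|$ over measurable $A$, which is $\frac12\int|p_X-p_Y|$ when densities exist. (All $\alpha_t$ lie in $(0,1)$ once $T$ is large in terms of $c_0,c_1$. For the finitely many smaller $T$ where this may fail, square roots of negative numbers, quotients by $0$ and undefined gradients or densities are read as $0$.) -/

import Mathlib

open MeasureTheory ProbabilityTheory
open scoped ENNReal

noncomputable section

/-- Total variation distance between two (probability) measures: the largest discrepancy
`|μ(A) - ν(A)|` over measurable events `A`. -/
def tvDist {Ω : Type*} [MeasurableSpace Ω] (μ ν : Measure Ω) : ℝ :=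
  ⨆ A : {A : Set Ω // MeasurableSet A}, |μ.real A.1 - ν.real A.1|

/-- For measures with densities `p` and `q`, the total variation distance is `(1/2) ∫ |p - q|`. -/
theorem tvDist_withDensity {Ω : Type*} [MeasurableSpace Ω] (m : Measure Ω) (p q : Ω → ℝ)
    (hp : Integrable p m) (hq : Integrable q m) (hpm : Measurable p) (hqm : Measurable q)
    (hp0 : ∀ x, 0 ≤ p x) (hq0 : ∀ x, 0 ≤ q x) (hpq : ∫ x, p x ∂m = ∫ x, q x ∂m) :
    tvDist (m.withDensity fun x => ENNReal.ofReal (p x))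
      (m.withDensity fun x => ENNReal.ofReal (q x)) = (1 / 2) * ∫ x, |p x - q x| ∂m := by
  have key : ∀ (r : Ω → ℝ), Integrable r m → (∀ x, 0 ≤ r x) → ∀ A, MeasurableSet A →
      (m.withDensity fun x => ENNReal.ofReal (r x)).real A = ∫ x in A, r x ∂m := by
    intro r hr hr0 A hA
    rw [measureReal_def, withDensity_apply _ hA, integral_eq_lintegral_of_nonneg_ae
      (Filter.Eventually.of_forall hr0) hr.aestronglyMeasurable.restrict]
  have hd : Integrable (fun x => p x - q x) m := hp.sub hq
  have hdiff : ∀ A, MeasurableSet A →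
      (m.withDensity fun x => ENNReal.ofReal (p x)).real A -
      (m.withDensity fun x => ENNReal.ofReal (q x)).real A = ∫ x in A, (p x - q x) ∂m := by
    intro A hA
    rw [key p hp hp0 A hA, key q hq hq0 A hA, integral_sub hp.integrableOn hq.integrableOn]
  have hzero : ∀ A, MeasurableSet A →
      ∫ x in A, (p x - q x) ∂m + ∫ x in Aᶜ, (p x - q x) ∂m = 0 := by
    intro A hA
    rw [integral_add_compl hA hd, integral_sub hp hq, hpq, sub_self]
  have habs : ∀ A, MeasurableSet A →
      ∫ x in A, |p x - q x| ∂m + ∫ x in Aᶜ, |p x - q x| ∂m = ∫ x, |p x - q x| ∂m :=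
    fun A hA => integral_add_compl hA hd.abs
  have hle : ∀ A, MeasurableSet A →
      |∫ x in A, (p x - q x) ∂m| ≤ (1 / 2) * ∫ x, |p x - q x| ∂m := by
    intro A hA
    have h1 := abs_integral_le_integral_abs (μ := m.restrict A) (f := fun x => p x - q x)
    have h2 := abs_integral_le_integral_abs (μ := m.restrict Aᶜ) (f := fun x => p x - q x)
    have h3 := hzero A hA
    have h4 := habs A hA
    have h5 : ∫ x in Aᶜ, (p x - q x) ∂m = -∫ x in A, (p x - q x) ∂m := by linarith
    rw [h5, abs_neg] at h2
    linarith
  unfold tvDist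
  apply le_antisymm
  · have : Nonempty {A : Set Ω // MeasurableSet A} := ⟨⟨∅, MeasurableSet.empty⟩⟩
    refine ciSup_le fun A => ?_
    rw [hdiff A.1 A.2]
    exact hle A.1 A.2
  · have hB : MeasurableSet {x | q x ≤ p x} := measurableSet_le hqm hpm
    have hbdd : BddAbove (Set.range fun A : {A : Set Ω // MeasurableSet A} =>
        |(m.withDensity fun x => ENNReal.ofReal (p x)).real A.1 -
          (m.withDensity fun x => ENNReal.ofReal (q x)).real A.1|) := by
      refine ⟨(1 / 2) * ∫ x, |p x - q x| ∂m, ?_⟩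
      rintro _ ⟨A, rfl⟩
      simp only
      rw [hdiff A.1 A.2]
      exact hle A.1 A.2
    refine le_trans ?_ (le_ciSup hbdd ⟨{x | q x ≤ p x}, hB⟩)
    simp only
    rw [hdiff _ hB]
    have e1 : ∫ x in {x | q x ≤ p x}, |p x - q x| ∂m =
        ∫ x in {x | q x ≤ p x}, (p x - q x) ∂m :=
      setIntegral_congr_fun hB fun x hx => abs_of_nonneg (sub_nonneg.2 hx)
    have e2 : ∫ x in {x | q x ≤ p x}ᶜ, |p x - q x| ∂m =
        ∫ x in {x | q x ≤ p x}ᶜ, -(p x - q x) ∂m :=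
      setIntegral_congr_fun hB.compl fun x hx =>
        abs_of_nonpos (sub_nonpos.2 (le_of_lt (not_le.1 hx)))
    rw [integral_neg] at e2
    have h3 := hzero _ hB
    have h4 := habs _ hB
    have h5 := le_abs_self (∫ x in {x | q x ≤ p x}, (p x - q x) ∂m)
    linarith

/-- The isotropic Gaussian mixture `∑ k, π k • N(μ k, I_d)` on `ℝ^d`. -/
def gmm {d K : ℕ} (π : Fin K → ℝ) (μ : Fin K → EuclideanSpace ℝ (Fin d)) :
    Measure (EuclideanSpace ℝ (Fin d)) :=
  ∑ k, ENNReal.ofReal (π k) • multivariateGaussian (μ k) 1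

open Classical in
/-- The continuous probability density function `p_X : ℝ^d → ℝ` (with respect to Lebesgue measure)
of a law on `ℝ^d`; it is unique when it exists, and `0` is the default when it does not. -/
def density {d : ℕ} (ρ : Measure (EuclideanSpace ℝ (Fin d))) : EuclideanSpace ℝ (Fin d) → ℝ :=
  if h : ∃ p : EuclideanSpace ℝ (Fin d) → ℝ, Continuous p ∧ (∀ x, 0 ≤ p x) ∧
      ρ = volume.withDensity (fun x => ENNReal.ofReal (p x))
  then h.choose else 0

/-- A continuous density of a finite measure is the one selected by `density`. -/
theorem density_eq {d : ℕ} (ρ : Measure (EuclideanSpace ℝ (Fin d))) [IsFiniteMeasure ρ]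
    (p : EuclideanSpace ℝ (Fin d) → ℝ) (hp : Continuous p) (hp0 : ∀ x, 0 ≤ p x)
    (hρ : ρ = volume.withDensity (fun x => ENNReal.ofReal (p x))) : density ρ = p := by
  have h : ∃ p : EuclideanSpace ℝ (Fin d) → ℝ, Continuous p ∧ (∀ x, 0 ≤ p x) ∧
      ρ = volume.withDensity (fun x => ENNReal.ofReal (p x)) := ⟨p, hp, hp0, hρ⟩
  unfold density
  rw [dif_pos h]
  obtain ⟨hc, h0, he⟩ := h.choose_spec
  generalize h.choose = g at hc h0 he
  refine (Continuous.ae_eq_iff_eq volume hc hp).1 ?_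
  have hfin : ∫⁻ x, ENNReal.ofReal (g x) ≠ ∞ := by
    have := measure_ne_top ρ Set.univ
    rwa [he, withDensity_apply _ MeasurableSet.univ, Measure.restrict_univ] at this
  have hae := (withDensity_eq_iff (hc.measurable.ennreal_ofReal.aemeasurable)
    (hp.measurable.ennreal_ofReal.aemeasurable) hfin).1 (he.symm.trans hρ)
  filter_upwards [hae] with x hx
  exact (ENNReal.ofReal_eq_ofReal_iff (h0 x) (hp0 x)).1 hx

/-- The (Stein) score function `x ↦ ∇ log p_X(x)` of a law on `ℝ^d`. -/
def score {d : ℕ} (ρ : Measure (EuclideanSpace ℝ (Fin d))) (x : EuclideanSpace ℝ (Fin d)) :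
    EuclideanSpace ℝ (Fin d) :=
  gradient (fun y => Real.log (density ρ y)) x

/-- `alphaBarRev c₀ c₁ T n` is the cumulative product `ᾱ_{T - n}`, computed backwards from
`ᾱ_T = 1 / T ^ c₀` by `ᾱ_{t-1} = ᾱ_t + c₁ (log T / T) ᾱ_t (1 - ᾱ_t)`. -/
def alphaBarRev (c₀ c₁ : ℝ) (T : ℕ) : ℕ → ℝ
  | 0 => 1 / (T : ℝ) ^ c₀
  | n + 1 => alphaBarRev c₀ c₁ T n +
      c₁ * (Real.log T / T) * alphaBarRev c₀ c₁ T n * (1 - alphaBarRev c₀ c₁ T n)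

/-- The cumulative products `ᾱ_t = ∏_{k ≤ t} α_k`, with `ᾱ_0 = 1` (the empty product) and the
values for `1 ≤ t ≤ T` given by the backward recursion. -/
def alphaBar (c₀ c₁ : ℝ) (T t : ℕ) : ℝ :=
  if t = 0 then 1 else alphaBarRev c₀ c₁ T (T - t)

/-- The learning rates `α_t = ᾱ_t / ᾱ_{t-1}`, `1 ≤ t ≤ T`. -/
def alpha (c₀ c₁ : ℝ) (T t : ℕ) : ℝ :=
  alphaBar c₀ c₁ T t / alphaBar c₀ c₁ T (t - 1)

/-- The law of `X_t` in the forward process `X_t = √α_t X_{t-1} + √(1 - α_t) W_t` started at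
`X_0 ∼ ρ₀`, where `W_t ∼ N(0, I_d)` is independent of `X_{t-1}`. -/
def forwardLaw {d : ℕ} (α : ℕ → ℝ) (ρ₀ : Measure (EuclideanSpace ℝ (Fin d))) :
    ℕ → Measure (EuclideanSpace ℝ (Fin d))
  | 0 => ρ₀
  | t + 1 => ((forwardLaw α ρ₀ t).prod (stdGaussian (EuclideanSpace ℝ (Fin d)))).map
      fun z => √(α (t + 1)) • z.1 + √(1 - α (t + 1)) • z.2

/-- The mean squared error `E_{X ∼ ρ} ‖s(X) - ∇ log p_X(X)‖²` of a score estimate `s`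
(possibly infinite). -/
def scoreError {d : ℕ} (ρ : Measure (EuclideanSpace ℝ (Fin d)))
    (s : EuclideanSpace ℝ (Fin d) → EuclideanSpace ℝ (Fin d)) : ℝ≥0∞ :=
  ∫⁻ x, ‖s x - score ρ x‖ₑ ^ 2 ∂ρ

open Classical in
/-- Hard truncation at Euclidean norm `R`: the identity on `‖x‖ ≤ R`, and `0` elsewhere. -/
def clip {d : ℕ} (R : ℝ) (x : EuclideanSpace ℝ (Fin d)) : EuclideanSpace ℝ (Fin d) :=
  if ‖x‖ ≤ R then x else 0

/-- The truncated score estimates `ŝ_t = clip{s_t}` with truncation level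
`C_clip √(d log(dT) / (1 - ᾱ_t))`. -/
def clippedScore {d : ℕ} (c₀ c₁ Cclip : ℝ) (T : ℕ)
    (s : ℕ → EuclideanSpace ℝ (Fin d) → EuclideanSpace ℝ (Fin d)) (t : ℕ)
    (x : EuclideanSpace ℝ (Fin d)) : EuclideanSpace ℝ (Fin d) :=
  clip (Cclip * √(d * Real.log (d * T) / (1 - alphaBar c₀ c₁ T t))) (s t x)

/-- `ddpmLawRev α ŝ T n` is the law of the DDPM iterate `Y_{T - n}`: `Y_T ∼ N(0, I_d)` and
`Y_{t-1} = (Y_t + (1 - α_t) ŝ_t(Y_t)) / √α_t + √(1 - α_t) Z_t` (here `t = T - n`), where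
`Z_t ∼ N(0, I_d)` is independent of `Y_t`. -/
def ddpmLawRev {d : ℕ} (α : ℕ → ℝ)
    (shat : ℕ → EuclideanSpace ℝ (Fin d) → EuclideanSpace ℝ (Fin d)) (T : ℕ) :
    ℕ → Measure (EuclideanSpace ℝ (Fin d))
  | 0 => stdGaussian (EuclideanSpace ℝ (Fin d))
  | n + 1 => ((ddpmLawRev α shat T n).prod (stdGaussian (EuclideanSpace ℝ (Fin d)))).map
      fun z => (1 / √(α (T - n))) • (z.1 + (1 - α (T - n)) • shat (T - n) z.1) +
        √(1 - α (T - n)) • z.2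

/-- The law of the output `Y_1` of the DDPM sampler run for `t = T, …, 2`, with the prescribed
learning rates and the truncated score estimates. -/
def ddpmOutputLaw {d : ℕ} (c₀ c₁ Cclip : ℝ) (T : ℕ)
    (s : ℕ → EuclideanSpace ℝ (Fin d) → EuclideanSpace ℝ (Fin d)) :
    Measure (EuclideanSpace ℝ (Fin d)) :=
  ddpmLawRev (alpha c₀ c₁ T) (clippedScore c₀ c₁ Cclip T s) T (T - 1)

end

/-!
Why the bound holds, and why it does not see the dimension.

Every law of the forward process is a Gaussian mixture with *unit* covariances: `X_t` has density
`mixDens π ν` with centres `ν = √ᾱ_t μ` (`forwardLaw_gmm`). Write `M(x)` for the posterior mean of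
the centre given `x`; then the score is `M(x) - x` (`score_gmm`). With the exact score, and with
`ρ = (1 - α_t) / α_t`, one step of the sampler factors as the Euler map `φ(x) = x + ρ M(x)`
followed by the Ornstein–Uhlenbeck step `x ↦ √α_t x + √(1 - α_t) Z`. The latter maps the mixture
with centres `(1 + ρ) ν` *exactly* to the law of `X_{t-1}` (`map_gmm_prod_stdGaussian`), so the
discretization error is the failure of `φ` to push the mixture with centres `ν` to the one with
centres `(1 + ρ) ν`.

This failure is measured by a change of variables. The derivative of `M` is the posterior covariance
`Σ(x)`, hence `det Dφ ≥ 1 + ρ tr Σ`, while Jensen's inequality bounds the ratio of the two mixture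
densities along `φ` below by `exp (-(ρ + ρ²/2) tr Σ)`. The terms of first order in `ρ` cancel, and
the total variation error of the step is at most `ρ² E[(tr Σ)² + tr Σ]`
(`lintegral_comp_add_smul_postMean_le`). Two components at distance `r` are confused with
probability of order `exp (-r² / 8)`, so `E[(tr Σ)²]` is of order `1 + log² K` in every dimension
(`lintegral_sq_postVar_le`). As `ρ ≤ c₁ log T / T`, the sum over `T` steps is of order
`log² T (1 + log² K) / T`.

The score error must enter through relative entropy, which adds up over steps before a square root
is taken, but under the forward marginals rather than those of the sampler. `EntropyTVBound`
accommodates both kinds of error: it is the Donsker–Varadhan inequality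
`∫ g dP ≤ ∫ (exp g - 1) dQ + D + lam δ` for all `0 ≤ g ≤ lam`, in which `D` collects relative
entropy and `δ` total variation. `EntropyTVBound.step` propagates it through one step of the
sampler, and `EntropyTVBound.measureReal_sub_le` recovers a bound `2 √D + δ` on total variation.

What remains is small. Truncating the score costs `O(T⁻²)` since the score has a Gaussian
exponential moment (`lintegral_clip_sub_score_le`, `clip_error_le`). The initial law `N(0, I)`
replaces the law of `X_T`, and `X_1` replaces `X_0`, at a cost controlled by `ᾱ_T = T^{-c₀}` and by
`1 - ᾱ_1 ≤ T^{-c₁ / 4}` (`one_sub_alphaBar_one_le`). When `T` is bounded in terms of `c₁` the claim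
holds because total variation is at most one.
-/

noncomputable section

variable {d K : ℕ}

local notation:max "𝔼^" d:max => EuclideanSpace ℝ (Fin d)

/-! ### The standard Gaussian and Gaussian mixtures -/

/-- The density of the standard Gaussian on `ℝ^d`. -/
def gaussDens (x : 𝔼^d) : ℝ := ((2 * Real.pi) ^ (d / 2 : ℝ))⁻¹ * Real.exp (-‖x‖ ^ 2 / 2)

/-- The density of the Gaussian mixture with weights `π` and centres `ν`. -/
def mixDens (π : Fin K → ℝ) (ν : Fin K → 𝔼^d) (x : 𝔼^d) : ℝ := ∑ k, π k * gaussDens (x - ν k)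

lemma gaussDens_pos (x : 𝔼^d) : 0 < gaussDens x := by unfold gaussDens; positivity

@[fun_prop]
lemma continuous_gaussDens : Continuous (gaussDens : 𝔼^d → ℝ) := by unfold gaussDens; fun_prop

@[fun_prop]
lemma continuous_mixDens (π : Fin K → ℝ) (ν : Fin K → 𝔼^d) : Continuous (mixDens π ν) := by
  unfold mixDens; fun_prop

lemma integrable_exp_neg_mul_sq_norm {b : ℝ} (hb : 0 < b) :
    Integrable (fun x : 𝔼^d => Real.exp (-b * ‖x‖ ^ 2)) := by
  have h := (GaussianFourier.integrable_cexp_neg_mul_sq_norm_add (V := 𝔼^d) (b := (b : ℂ))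
    (by simpa using hb) 0 0).norm
  refine h.congr (Filter.Eventually.of_forall fun x => ?_)
  simp only [Complex.norm_exp]
  norm_num
  norm_cast
  exact Or.inl rfl

lemma integrable_gaussDens : Integrable (gaussDens : 𝔼^d → ℝ) := by
  unfold gaussDens
  refine ((integrable_exp_neg_mul_sq_norm (d := d) (b := 1 / 2) (by norm_num)).congr
    (Filter.Eventually.of_forall fun x => ?_)).const_mul _
  simp only []
  congr 1; ring

lemma integral_gaussDens : ∫ x : 𝔼^d, gaussDens x = 1 := by
  unfold gaussDens
  rw [integral_const_mul]
  have := GaussianFourier.integral_rexp_neg_mul_sq_norm (V := 𝔼^d) (b := 1 / 2) (by norm_num)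
  rw [show (fun x : 𝔼^d => Real.exp (-‖x‖ ^ 2 / 2)) =
      fun x : 𝔼^d => Real.exp (-(1 / 2) * ‖x‖ ^ 2) by
    ext x; congr 1; ring, this]
  rw [show Real.pi / (1 / 2) = 2 * Real.pi by ring]
  simp only [finrank_euclideanSpace, Fintype.card_fin]
  exact inv_mul_cancel₀ (by positivity)

lemma stdGaussian_eq_withDensity :
    stdGaussian 𝔼^d = volume.withDensity fun x => ENNReal.ofReal (gaussDens x) := by
  have hfin : IsFiniteMeasure (volume.withDensity fun x : 𝔼^d => ENNReal.ofReal (gaussDens x)) :=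
    isFiniteMeasure_withDensity_ofReal integrable_gaussDens.2
  refine Measure.ext_of_charFun ?_
  ext t
  rw [charFun_stdGaussian, charFun_apply, integral_withDensity_eq_integral_toReal_smul
    (by fun_prop) (by simp)]
  have h := GaussianFourier.integral_cexp_neg_mul_sq_norm_add (V := 𝔼^d) (b := (1 / 2 : ℂ))
    (by norm_num) Complex.I t
  have h2 : ∀ x : 𝔼^d, (ENNReal.ofReal (gaussDens x)).toReal •
      Complex.exp ((inner ℝ x t : ℝ) * Complex.I) =
      (((2 * Real.pi) ^ (d / 2 : ℝ))⁻¹ : ℝ) *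
        Complex.exp (-(1 / 2) * ‖x‖ ^ 2 + Complex.I * (inner ℝ t x : ℝ)) := by
    intro x
    rw [ENNReal.toReal_ofReal (gaussDens_pos x).le, gaussDens, Complex.exp_add]
    simp only [Complex.real_smul, Complex.ofReal_mul, Complex.ofReal_exp]
    rw [real_inner_comm]
    push_cast
    rw [mul_comm Complex.I]
    rw [show -(‖x‖ : ℂ) ^ 2 / 2 = -(1 / 2) * ‖x‖ ^ 2 by ring]
    ring
  simp_rw [h2]
  rw [integral_const_mul, h]
  have h3 : ((Real.pi : ℂ) / (1 / 2)) ^ (Module.finrank ℝ 𝔼^d / 2 : ℂ) =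
      (((2 * Real.pi) ^ (d / 2 : ℝ) : ℝ) : ℂ) := by
    rw [Complex.ofReal_cpow (by positivity)]
    simp only [finrank_euclideanSpace, Fintype.card_fin]
    push_cast
    congr 1; ring
  rw [h3, ← mul_assoc, ← Complex.ofReal_mul, inv_mul_cancel₀ (by positivity)]
  simp only [Complex.ofReal_one, one_mul]
  congr 1
  rw [Complex.I_sq]; ring

lemma lintegral_stdGaussian {f : 𝔼^d → ℝ≥0∞} (hf : Measurable f) :
    ∫⁻ x, f x ∂stdGaussian 𝔼^d = ∫⁻ x, ENNReal.ofReal (gaussDens x) * f x := by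
  rw [stdGaussian_eq_withDensity, lintegral_withDensity_eq_lintegral_mul _ (by fun_prop) hf]
  rfl

lemma multivariateGaussian_one_eq_map (m : 𝔼^d) :
    multivariateGaussian m 1 = (stdGaussian 𝔼^d).map (fun x => m + x) := by
  simp [multivariateGaussian]

/-- Integration against a Gaussian mixture, component by component. -/
lemma lintegral_gmm (π : Fin K → ℝ) (ν : Fin K → 𝔼^d) {f : 𝔼^d → ℝ≥0∞} (hf : Measurable f) :
    ∫⁻ x, f x ∂gmm π ν = ∑ k, ENNReal.ofReal (π k) * ∫⁻ z, f (ν k + z) ∂stdGaussian 𝔼^d := by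
  unfold gmm
  rw [lintegral_finsetSum_measure]
  refine Finset.sum_congr rfl fun k _ => ?_
  rw [lintegral_smul_measure, multivariateGaussian_one_eq_map, lintegral_map hf (by fun_prop)]
  rfl

lemma gmm_eq_withDensity {π : Fin K → ℝ} (hπ : ∀ k, 0 ≤ π k) (ν : Fin K → 𝔼^d) :
    gmm π ν = volume.withDensity fun x => ENNReal.ofReal (mixDens π ν x) := by
  refine Measure.ext_of_lintegral _ fun f hf => ?_
  rw [lintegral_gmm π ν hf, lintegral_withDensity_eq_lintegral_mul _ (by fun_prop) hf]
  simp only [Pi.mul_apply, mixDens]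
  have h1 : ∀ x : 𝔼^d, ENNReal.ofReal (∑ k, π k * gaussDens (x - ν k)) * f x =
      ∑ k, ENNReal.ofReal (π k) * (ENNReal.ofReal (gaussDens (x - ν k)) * f x) := by
    intro x
    rw [ENNReal.ofReal_sum_of_nonneg fun k _ => mul_nonneg (hπ k) (gaussDens_pos _).le,
      Finset.sum_mul]
    exact Finset.sum_congr rfl fun k _ => by rw [ENNReal.ofReal_mul (hπ k), mul_assoc]
  simp_rw [h1]
  rw [lintegral_finsetSum _ (by fun_prop)]
  refine Finset.sum_congr rfl fun k _ => ?_
  rw [lintegral_const_mul _ (by fun_prop), lintegral_stdGaussian (by fun_prop)]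
  congr 1
  rw [← lintegral_add_right_eq_self
    (fun x => ENNReal.ofReal (gaussDens (x - ν k)) * f x) (ν k)]
  exact lintegral_congr fun z => by rw [add_sub_cancel_right, add_comm]

instance isFiniteMeasure_gmm (π : Fin K → ℝ) (ν : Fin K → 𝔼^d) : IsFiniteMeasure (gmm π ν) := by
  constructor
  rw [← lintegral_one, lintegral_gmm π ν measurable_const]
  simp [ENNReal.sum_lt_top]

lemma isProbabilityMeasure_gmm {π : Fin K → ℝ} (hπ : ∀ k, 0 ≤ π k) (h1 : ∑ k, π k = 1)
    (ν : Fin K → 𝔼^d) : IsProbabilityMeasure (gmm π ν) := by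
  constructor
  rw [← lintegral_one, lintegral_gmm π ν measurable_const]
  simp only [lintegral_const, measure_univ, mul_one]
  rw [← ENNReal.ofReal_sum_of_nonneg fun k _ => hπ k, h1, ENNReal.ofReal_one]

/-- A measurable function with values in `[0, lam]` is integrable against a finite measure. -/
lemma integrable_of_mem_Icc {Ω : Type*} [MeasurableSpace Ω] {P : Measure Ω} [IsFiniteMeasure P]
    {g : Ω → ℝ} {lam : ℝ} (hg : Measurable g) (h0 : ∀ x, 0 ≤ g x) (h1 : ∀ x, g x ≤ lam) :
    Integrable g P :=
  Integrable.of_bound hg.aestronglyMeasurable lam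
    (Filter.Eventually.of_forall fun x => by rw [Real.norm_of_nonneg (h0 x)]; exact h1 x)

lemma integral_gmm {π : Fin K → ℝ} (hπ : ∀ k, 0 ≤ π k) (ν : Fin K → 𝔼^d) {g : 𝔼^d → ℝ} {lam : ℝ}
    (hg : Measurable g) (h0 : ∀ x, 0 ≤ g x) (h1 : ∀ x, g x ≤ lam) :
    ∫ x, g x ∂gmm π ν = ∑ k, π k * ∫ z, g (ν k + z) ∂stdGaussian 𝔼^d := by
  unfold gmm
  rw [integral_finsetSum_measure]
  · refine Finset.sum_congr rfl fun k _ => ?_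
    rw [integral_smul_measure, multivariateGaussian_one_eq_map,
      integral_map (by fun_prop) hg.aestronglyMeasurable, ENNReal.toReal_ofReal (hπ k), smul_eq_mul]
  · intro k _
    exact (integrable_of_mem_Icc hg h0 h1).smul_measure (by simp)

/-- One Ornstein–Uhlenbeck step keeps the components standard and contracts the centres. -/
lemma map_gmm_prod_stdGaussian (π : Fin K → ℝ) (ν : Fin K → 𝔼^d) {α : ℝ} (h0 : 0 ≤ α)
    (h1 : α ≤ 1) :
    ((gmm π ν).prod (stdGaussian 𝔼^d)).map (fun z => √α • z.1 + √(1 - α) • z.2) =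
      gmm π (fun k => √α • ν k) := by
  -- the sum of two independent centred Gaussians of variances `α` and `1 - α`
  have key : ((stdGaussian 𝔼^d).prod (stdGaussian 𝔼^d)).map (fun z => √α • z.1 + √(1 - α) • z.2) =
      stdGaussian 𝔼^d := by
    have : ((stdGaussian 𝔼^d).prod (stdGaussian 𝔼^d)).map (fun z => √α • z.1 + √(1 - α) • z.2) =
        ((stdGaussian 𝔼^d).map (fun x => √α • x)).conv
          ((stdGaussian 𝔼^d).map (fun x => √(1 - α) • x)) := by
      rw [Measure.conv, Measure.map_prod_map _ _ (by fun_prop) (by fun_prop),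
        Measure.map_map (by fun_prop) (by fun_prop)]
      rfl
    rw [this]
    refine Measure.ext_of_charFun ?_
    ext t
    rw [charFun_conv, charFun_map_smul, charFun_map_smul]
    simp only [charFun_stdGaussian]
    rw [← Complex.exp_add]
    congr 1
    rw [norm_smul, norm_smul, Real.norm_of_nonneg (Real.sqrt_nonneg _),
      Real.norm_of_nonneg (Real.sqrt_nonneg _)]
    rw [← Complex.ofReal_pow, ← Complex.ofReal_pow, mul_pow, mul_pow, Real.sq_sqrt h0,
      Real.sq_sqrt (by linarith)]
    push_cast
    ring
  refine Measure.ext_of_lintegral _ fun f hf => ?_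
  rw [lintegral_map hf (by fun_prop), lintegral_prod _ (by fun_prop),
    lintegral_gmm _ _ (by fun_prop), lintegral_gmm _ _ hf]
  refine Finset.sum_congr rfl fun k _ => ?_
  congr 1
  conv_rhs => rw [← key]
  rw [lintegral_map (by fun_prop) (by fun_prop), lintegral_prod _ (by fun_prop)]
  simp only [smul_add, add_assoc]

/-! ### Transport of exponential moments between Gaussians -/

/-- Change of variables for a shift of the standard Gaussian. -/
lemma lintegral_stdGaussian_add {f : 𝔼^d → ℝ≥0∞} (hf : Measurable f) (h : 𝔼^d) :
    ∫⁻ z, f (z + h) ∂stdGaussian 𝔼^d =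
      ∫⁻ z, ENNReal.ofReal (Real.exp ((inner ℝ z h : ℝ) - ‖h‖ ^ 2 / 2)) * f z ∂stdGaussian 𝔼^d := by
  rw [lintegral_stdGaussian (by fun_prop), lintegral_stdGaussian (by fun_prop),
    ← lintegral_add_right_eq_self _ h]
  conv_rhs => rw [← lintegral_add_right_eq_self _ h]
  rw [lintegral_add_right_eq_self (fun z => ENNReal.ofReal (gaussDens z) * f (z + h))]
  refine lintegral_congr fun z => ?_
  rw [← mul_assoc, ← ENNReal.ofReal_mul (gaussDens_pos _).le]
  congr 2
  unfold gaussDens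
  rw [mul_assoc, ← Real.exp_add]
  congr 2
  rw [norm_add_sq_real, inner_add_left, real_inner_self_eq_norm_sq]
  ring

/-- The Donsker–Varadhan inequality for two Gaussians with the same isotropic covariance, whose
relative entropy is `‖m₁ - m₂‖² / (2 σ²)`. -/
lemma integral_gaussian_le_log_integral_exp {g : 𝔼^d → ℝ} {lam : ℝ} (hg : Measurable g)
    (h0 : ∀ x, 0 ≤ g x) (h1 : ∀ x, g x ≤ lam) (m₁ m₂ : 𝔼^d) {σ : ℝ} (hσ : 0 < σ) :
    ∫ z, g (m₁ + σ • z) ∂stdGaussian 𝔼^d ≤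
      Real.log (∫ z, Real.exp (g (m₂ + σ • z)) ∂stdGaussian 𝔼^d) + ‖m₁ - m₂‖ ^ 2 / (2 * σ ^ 2) := by
  set h : 𝔼^d := σ⁻¹ • (m₂ - m₁) with hh
  set e : 𝔼^d → ℝ := fun z => g (m₁ + σ • z) + ((inner ℝ z h : ℝ) - ‖h‖ ^ 2 / 2) with he
  have hm : ∀ z : 𝔼^d, m₂ + σ • z = m₁ + σ • (z + h) := by
    intro z
    rw [hh, smul_add, smul_smul, mul_inv_cancel₀ hσ.ne', one_smul]
    abel
  have hgi : Integrable (fun z => g (m₁ + σ • z)) (stdGaussian 𝔼^d) :=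
    integrable_of_mem_Icc (hg.comp (by fun_prop)) (fun _ => h0 _) (fun _ => h1 _)
  have hin : Integrable (fun z : 𝔼^d => (inner ℝ z h : ℝ)) (stdGaussian 𝔼^d) :=
    (IsGaussian.integrable_id (μ := stdGaussian 𝔼^d)).inner_const h
  have hin0 : ∫ z : 𝔼^d, (inner ℝ z h : ℝ) ∂stdGaussian 𝔼^d = 0 := by
    have := integral_strongDual_stdGaussian (innerSL ℝ h)
    simpa [innerSL_apply_apply, real_inner_comm] using this
  have hin' : Integrable (fun z : 𝔼^d => (inner ℝ z h : ℝ) - ‖h‖ ^ 2 / 2) (stdGaussian 𝔼^d) :=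
    hin.sub (integrable_const _)
  have hei : Integrable e (stdGaussian 𝔼^d) := hgi.add hin'
  have hexp : Integrable (fun z => Real.exp (g (m₂ + σ • z))) (stdGaussian 𝔼^d) :=
    integrable_of_mem_Icc (lam := Real.exp lam) (Real.measurable_exp.comp (hg.comp (by fun_prop)))
      (fun _ => (Real.exp_pos _).le) (fun _ => Real.exp_le_exp.2 (h1 _))
  have hmeas : Measurable fun z : 𝔼^d => Real.exp (e z) := by
    refine Real.measurable_exp.comp ((hg.comp (by fun_prop)).add (by fun_prop))
  have hlin : ∫⁻ z, ENNReal.ofReal (Real.exp (g (m₂ + σ • z))) ∂stdGaussian 𝔼^d =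
      ∫⁻ z, ENNReal.ofReal (Real.exp (e z)) ∂stdGaussian 𝔼^d := by
    simp_rw [hm]
    rw [lintegral_stdGaussian_add (f := fun z => ENNReal.ofReal (Real.exp (g (m₁ + σ • z))))
      ((Real.measurable_exp.comp (hg.comp (by fun_prop))).ennreal_ofReal)]
    refine lintegral_congr fun z => ?_
    rw [← ENNReal.ofReal_mul (Real.exp_pos _).le, ← Real.exp_add, he, add_comm]
  have heq : ∫ z, Real.exp (g (m₂ + σ • z)) ∂stdGaussian 𝔼^d =
      ∫ z, Real.exp (e z) ∂stdGaussian 𝔼^d := by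
    rw [integral_eq_lintegral_of_nonneg_ae
      (Filter.Eventually.of_forall fun _ => (Real.exp_pos _).le)
      hexp.aestronglyMeasurable,
      integral_eq_lintegral_of_nonneg_ae (Filter.Eventually.of_forall fun _ => (Real.exp_pos _).le)
      hmeas.aestronglyMeasurable, hlin]
  have hexpe : Integrable (fun z => Real.exp (e z)) (stdGaussian 𝔼^d) := by
    refine ⟨hmeas.aestronglyMeasurable, ?_⟩
    rw [hasFiniteIntegral_iff_ofReal (Filter.Eventually.of_forall fun _ => (Real.exp_pos _).le),
      ← hlin, ← hasFiniteIntegral_iff_ofReal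
        (Filter.Eventually.of_forall fun _ => (Real.exp_pos _).le)]
    exact hexp.2
  have hJ : Real.exp (∫ z, e z ∂stdGaussian 𝔼^d) ≤ ∫ z, Real.exp (e z) ∂stdGaussian 𝔼^d :=
    convexOn_exp.map_integral_le Real.continuous_exp.continuousOn isClosed_univ
      (Filter.Eventually.of_forall fun _ => Set.mem_univ _) hei hexpe
  have hint : ∫ z, e z ∂stdGaussian 𝔼^d =
      ∫ z, g (m₁ + σ • z) ∂stdGaussian 𝔼^d - ‖m₁ - m₂‖ ^ 2 / (2 * σ ^ 2) := by
    rw [he, integral_add hgi hin', integral_sub hin (integrable_const _),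
      hin0, hh, norm_smul, norm_inv, Real.norm_of_nonneg hσ.le, norm_sub_rev m₂ m₁]
    simp only [integral_const, probReal_univ, smul_eq_mul]
    field_simp
    ring
  have := (Real.le_log_iff_exp_le ((Real.exp_pos _).trans_le hJ)).2 hJ
  rw [heq]
  linarith

/-! ### Posterior weights, mean and covariance; the score of a mixture -/

/-- The posterior probability of the component `k` given the observation `x`. -/
def post (π : Fin K → ℝ) (ν : Fin K → 𝔼^d) (x : 𝔼^d) (k : Fin K) : ℝ :=
  π k * gaussDens (x - ν k) / mixDens π ν x

/-- The posterior mean of the centre given the observation `x`. -/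
def postMean (π : Fin K → ℝ) (ν : Fin K → 𝔼^d) (x : 𝔼^d) : 𝔼^d := ∑ k, post π ν x k • ν k

/-- The posterior variance of the centre given `x`: the trace of its covariance operator. -/
def postVar (π : Fin K → ℝ) (ν : Fin K → 𝔼^d) (x : 𝔼^d) : ℝ :=
  ∑ k, post π ν x k * ‖ν k - postMean π ν x‖ ^ 2

/-- The posterior covariance operator of the centre given `x`. -/
def postCov (π : Fin K → ℝ) (ν : Fin K → 𝔼^d) (x : 𝔼^d) : 𝔼^d →L[ℝ] 𝔼^d :=
  ∑ k, post π ν x k •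
    InnerProductSpace.rankOne ℝ (ν k - postMean π ν x) (ν k - postMean π ν x)

lemma mixDens_nonneg {π : Fin K → ℝ} (hπ : ∀ k, 0 ≤ π k) (ν : Fin K → 𝔼^d) (x : 𝔼^d) :
    0 ≤ mixDens π ν x :=
  Finset.sum_nonneg fun k _ => mul_nonneg (hπ k) (gaussDens_pos _).le

lemma mixDens_pos {π : Fin K → ℝ} (hπ : ∀ k, 0 < π k) (h1 : ∑ k, π k = 1) (ν : Fin K → 𝔼^d)
    (x : 𝔼^d) : 0 < mixDens π ν x := by
  have hne : (Finset.univ : Finset (Fin K)).Nonempty := by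
    rw [Finset.nonempty_iff_ne_empty]
    intro h
    rw [h] at h1
    simp at h1
  exact Finset.sum_pos (fun k _ => mul_pos (hπ k) (gaussDens_pos _)) hne

section Posterior

variable {π : Fin K → ℝ} (hπ : ∀ k, 0 < π k) (h1 : ∑ k, π k = 1) (ν : Fin K → 𝔼^d)
include hπ h1

lemma post_nonneg (x : 𝔼^d) (k : Fin K) : 0 ≤ post π ν x k :=
  div_nonneg (mul_nonneg (hπ k).le (gaussDens_pos _).le) (mixDens_pos hπ h1 ν x).le

lemma sum_post (x : 𝔼^d) : ∑ k, post π ν x k = 1 := by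
  unfold post
  rw [← Finset.sum_div]
  exact div_self (mixDens_pos hπ h1 ν x).ne'

lemma mixDens_mul_post (x : 𝔼^d) (k : Fin K) :
    mixDens π ν x * post π ν x k = π k * gaussDens (x - ν k) :=
  mul_div_cancel₀ _ (mixDens_pos hπ h1 ν x).ne'

lemma continuous_post (k : Fin K) : Continuous fun x => post π ν x k := by
  unfold post
  exact Continuous.div (by fun_prop) (by fun_prop) fun x => (mixDens_pos hπ h1 ν x).ne'

lemma continuous_postMean : Continuous (postMean π ν) := by
  unfold postMean
  exact continuous_finsetSum _ fun k _ => (continuous_post hπ h1 ν k).smul continuous_const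

lemma continuous_postVar : Continuous (postVar π ν) := by
  unfold postVar
  refine continuous_finsetSum _ fun k _ => (continuous_post hπ h1 ν k).mul ?_
  exact (continuous_const.sub (continuous_postMean hπ h1 ν)).norm.pow 2

lemma postVar_nonneg (x : 𝔼^d) : 0 ≤ postVar π ν x :=
  Finset.sum_nonneg fun k _ => mul_nonneg (post_nonneg hπ h1 ν x k) (sq_nonneg _)

/-- The posterior deviations from the posterior mean average to zero. -/
lemma sum_post_smul_sub (x : 𝔼^d) : ∑ k, post π ν x k • (ν k - postMean π ν x) = 0 := by
  simp only [smul_sub, Finset.sum_sub_distrib, ← Finset.sum_smul, sum_post hπ h1 ν x, one_smul]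
  exact sub_self _

omit hπ h1 in
lemma hasFDerivAt_gaussDens (m x : 𝔼^d) :
    HasFDerivAt (fun y => gaussDens (y - m)) (-(gaussDens (x - m)) • innerSL ℝ (x - m)) x := by
  unfold gaussDens
  have h := ((((hasFDerivAt_id (𝕜 := ℝ) x).sub_const m).norm_sq.mul_const (-1 / 2)).exp).const_mul
    (((2 * Real.pi) ^ (d / 2 : ℝ))⁻¹)
  refine (h.congr_of_eventuallyEq (Filter.Eventually.of_forall fun y => ?_)).congr_fderiv ?_
  · simp only [id]
    congr 2; ring
  · ext v
    simp
    rw [show -‖x - m‖ ^ 2 / 2 = ‖x - m‖ ^ 2 * (-1 / 2) by ring]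
    ring

lemma hasFDerivAt_mixDens (x : 𝔼^d) :
    HasFDerivAt (mixDens π ν) (mixDens π ν x • innerSL ℝ (postMean π ν x - x)) x := by
  unfold mixDens
  refine (HasFDerivAt.fun_sum fun k _ =>
    (hasFDerivAt_gaussDens (ν k) x).const_mul (π k)).congr_fderiv ?_
  ext v
  have h2 : ∀ k, π k * gaussDens (x - ν k) = mixDens π ν x * post π ν x k := fun k =>
    (mixDens_mul_post hπ h1 ν x k).symm
  simp only [sum_apply, smul_apply, innerSL_apply_apply,
    smul_eq_mul]
  have h3 : ∀ k, π k * (-gaussDens (x - ν k) * inner ℝ (x - ν k) v) =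
      mixDens π ν x * (post π ν x k * (inner ℝ (ν k) v - inner ℝ x v)) := by
    intro k
    rw [← mul_assoc (mixDens π ν x), ← h2, inner_sub_left]; ring
  simp_rw [h3, ← Finset.mul_sum, mul_sub, Finset.sum_sub_distrib, ← Finset.sum_mul,
    sum_post hπ h1 ν x]
  rw [show (∑ k, π k * gaussDens (x - ν k)) = mixDens π ν x from rfl, inner_sub_left, postMean,
    sum_inner]
  simp_rw [real_inner_smul_left]
  ring

/-- The score of a Gaussian mixture with unit covariances (Tweedie's formula). -/
lemma score_gmm (x : 𝔼^d) : score (gmm π ν) x = postMean π ν x - x := by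
  unfold score
  rw [density_eq (gmm π ν) (mixDens π ν) (by fun_prop) (mixDens_nonneg (fun k => (hπ k).le) ν)
    (gmm_eq_withDensity (fun k => (hπ k).le) ν)]
  refine HasGradientAt.gradient (hasGradientAt_iff_hasFDerivAt.2 ?_)
  refine ((hasFDerivAt_mixDens hπ h1 ν x).log (mixDens_pos hπ h1 ν x).ne').congr_fderiv ?_
  ext v
  simp [(mixDens_pos hπ h1 ν x).ne']

lemma hasFDerivAt_post (x : 𝔼^d) (k : Fin K) :
    HasFDerivAt (fun y => post π ν y k)
      (post π ν x k • innerSL ℝ (ν k - postMean π ν x)) x := by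
  simp only [post, div_eq_mul_inv]
  have hp := (mixDens_pos hπ h1 ν x).ne'
  refine (((hasFDerivAt_gaussDens (ν k) x).const_mul (π k)).mul
    ((hasDerivAt_inv hp).comp_hasFDerivAt x (hasFDerivAt_mixDens hπ h1 ν x))).congr_fderiv ?_
  ext v
  simp only [smul_apply, sub_apply, add_apply, innerSL_apply_apply, smul_eq_mul,
    map_sub, Function.comp_apply]
  field_simp
  ring

/-- The derivative of the posterior mean is the posterior covariance. -/
lemma hasFDerivAt_postMean (x : 𝔼^d) : HasFDerivAt (postMean π ν) (postCov π ν x) x := by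
  have h : HasFDerivAt (postMean π ν) _ x :=
    HasFDerivAt.fun_sum fun k _ => (hasFDerivAt_post hπ h1 ν x k).smul_const (ν k)
  refine h.congr_fderiv ?_
  ext1 v
  simp only [postCov, sum_apply, smul_apply,
    ContinuousLinearMap.smulRight_apply, innerSL_apply_apply, InnerProductSpace.rankOne_apply,
    smul_eq_mul]
  -- the two sides differ by the mean of the deviations, which vanishes
  have h0 := congrArg (fun w => (inner ℝ w v : ℝ)) (sum_post_smul_sub hπ h1 ν x)
  simp only [sum_inner, real_inner_smul_left, inner_zero_left] at h0
  simp only [smul_sub, Finset.sum_sub_distrib, smul_smul, ← Finset.sum_smul, h0, zero_smul,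
    sub_zero]

lemma inner_postCov_nonneg (x v : 𝔼^d) : 0 ≤ (inner ℝ (postCov π ν x v) v : ℝ) := by
  simp only [postCov, sum_apply, smul_apply,
    InnerProductSpace.rankOne_apply, sum_inner, real_inner_smul_left]
  exact Finset.sum_nonneg fun k _ => mul_nonneg (post_nonneg hπ h1 ν x k) (mul_self_nonneg _)

omit hπ h1 in
lemma isSymmetric_postCov (x : 𝔼^d) : (postCov π ν x : 𝔼^d →ₗ[ℝ] 𝔼^d).IsSymmetric := by
  intro v w
  simp only [postCov, ContinuousLinearMap.coe_coe, sum_apply,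
    smul_apply, InnerProductSpace.rankOne_apply, sum_inner, inner_sum,
    real_inner_smul_left, real_inner_smul_right]
  exact Finset.sum_congr rfl fun k _ => by rw [real_inner_comm v]; ring

omit hπ h1 in
lemma trace_postCov (x : 𝔼^d) :
    LinearMap.trace ℝ 𝔼^d (postCov π ν x : 𝔼^d →ₗ[ℝ] 𝔼^d) = postVar π ν x := by
  simp only [postCov, postVar, ContinuousLinearMap.toLinearMap_sum,
    ContinuousLinearMap.toLinearMap_smul, map_sum, map_smul, InnerProductSpace.trace_rankOne,
    real_inner_self_eq_norm_sq, smul_eq_mul]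

end Posterior

lemma one_add_sum_sub_one_le_prod {ι : Type*} (s : Finset ι) {f : ι → ℝ} (hf : ∀ i, 1 ≤ f i) :
    1 + ∑ i ∈ s, (f i - 1) ≤ ∏ i ∈ s, f i := by
  classical
  induction s using Finset.induction_on with
  | empty => simp
  | insert a s ha ih =>
    rw [Finset.sum_insert ha, Finset.prod_insert ha]
    have h := Finset.sum_nonneg fun i (_ : i ∈ s) => sub_nonneg.2 (hf i)
    nlinarith [hf a]

/-- For a symmetric positive semidefinite operator `A`, `det (1 + A) ≥ 1 + tr A`. -/
lemma one_add_trace_le_det_one_add {V : Type*} [NormedAddCommGroup V] [InnerProductSpace ℝ V]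
    [FiniteDimensional ℝ V] {A : V →ₗ[ℝ] V} (hs : A.IsSymmetric)
    (hp : ∀ v, 0 ≤ (inner ℝ (A v) v : ℝ)) :
    1 + LinearMap.trace ℝ V A ≤ LinearMap.det (1 + A) := by
  have hs' : (1 + A).IsSymmetric := LinearMap.IsSymmetric.add (fun _ _ => rfl) hs
  have hev : ∀ i, 1 ≤ hs'.eigenvalues rfl i := by
    intro i
    have h := hs'.apply_eigenvectorBasis rfl i
    set e := hs'.eigenvectorBasis rfl i
    have hn : (inner ℝ e e : ℝ) = 1 := by
      rw [real_inner_self_eq_norm_sq, (hs'.eigenvectorBasis rfl).norm_eq_one i]; norm_num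
    have h2 := congrArg (fun w => (inner ℝ w e : ℝ)) h
    simp only [LinearMap.add_apply, Module.End.one_apply, inner_add_left, hn] at h2
    rw [real_inner_smul_left, hn] at h2
    have := hp e
    simp at h2
    linarith
  rw [hs'.det_eq_prod_eigenvalues rfl]
  have htr := hs'.trace_eq_sum_eigenvalues (n := Module.finrank ℝ V) rfl
  rw [map_add, LinearMap.trace_one] at htr
  have := one_add_sum_sub_one_le_prod Finset.univ hev
  simp only [Finset.sum_sub_distrib, Finset.sum_const, Finset.card_univ, Fintype.card_fin,
    nsmul_eq_mul, mul_one] at this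
  simp only [RCLike.ofReal_real_eq_id, id] at htr ⊢
  linarith

/-! ### The one-step error of the Euler scheme for the probability flow -/

section Euler

variable {π : Fin K → ℝ} (hπ : ∀ k, 0 < π k) (h1 : ∑ k, π k = 1) (ν : Fin K → 𝔼^d)
include hπ h1

lemma hasFDerivAt_add_smul_postMean (ρ : ℝ) (x : 𝔼^d) :
    HasFDerivAt (fun y => y + ρ • postMean π ν y) (1 + ρ • postCov π ν x) x :=
  (hasFDerivAt_id x).add ((hasFDerivAt_postMean hπ h1 ν x).const_smul ρ)

/-- The Euler map is injective, being strictly monotone. -/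
lemma injective_add_smul_postMean {ρ : ℝ} (hρ : 0 ≤ ρ) :
    Function.Injective fun y => y + ρ • postMean π ν y := by
  intro x y hxy
  by_contra hne
  set v := y - x with hv
  have hv0 : 0 < ‖v‖ ^ 2 := by
    have : v ≠ 0 := sub_ne_zero.2 (Ne.symm hne)
    positivity
  set φ : 𝔼^d → 𝔼^d := fun y => y + ρ • postMean π ν y with hφ
  have hd : ∀ s : ℝ, HasDerivAt (fun s : ℝ => (inner ℝ (φ (x + s • v)) v : ℝ))
      (inner ℝ ((1 + ρ • postCov π ν (x + s • v)) v) v : ℝ) s := by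
    intro s
    have hl : HasDerivAt (fun s : ℝ => x + s • v) v s := by
      simpa using ((hasDerivAt_id s).smul_const v).const_add x
    have := (hasFDerivAt_add_smul_postMean hπ h1 ν ρ (x + s • v)).comp_hasDerivAt s hl
    simpa using this.inner ℝ (hasDerivAt_const s v)
  have hmono : StrictMono fun s : ℝ => (inner ℝ (φ (x + s • v)) v : ℝ) := by
    refine strictMono_of_deriv_pos fun s => ?_
    rw [(hd s).deriv]
    simp only [add_apply, smul_apply, inner_add_left, real_inner_smul_left]
    rw [show (1 : 𝔼^d →L[ℝ] 𝔼^d) v = v from rfl, real_inner_self_eq_norm_sq]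
    have := mul_nonneg hρ (inner_postCov_nonneg hπ h1 ν (x + s • v) v)
    linarith
  have := hmono (zero_lt_one)
  simp only [zero_smul, add_zero, one_smul, hv, add_sub_cancel] at this
  rw [hxy] at this
  exact lt_irrefl _ this

lemma one_add_le_det (x : 𝔼^d) {ρ : ℝ} (hρ : 0 ≤ ρ) :
    1 + ρ * postVar π ν x ≤ (1 + ρ • postCov π ν x : 𝔼^d →L[ℝ] 𝔼^d).det := by
  have hs : (ρ • (postCov π ν x : 𝔼^d →ₗ[ℝ] 𝔼^d)).IsSymmetric :=
    (isSymmetric_postCov ν x).smul (by simp)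
  have := one_add_trace_le_det_one_add hs fun v => by
    simp only [LinearMap.smul_apply, real_inner_smul_left]
    exact mul_nonneg hρ (inner_postCov_nonneg hπ h1 ν x v)
  rw [map_smul, trace_postCov] at this
  exact this

/-- Along the Euler map the mixture density with dilated centres loses at most the factor
`exp (-(ρ + ρ²/2) V)`, by Jensen's inequality for the posterior weights. -/
lemma mixDens_mul_exp_le (ρ : ℝ) (x : 𝔼^d) :
    mixDens π ν x * Real.exp (-(ρ * postVar π ν x) - ρ ^ 2 * postVar π ν x / 2) ≤
      mixDens π (fun k => (1 + ρ) • ν k) (x + ρ • postMean π ν x) := by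
  set M := postMean π ν x with hM
  set e : Fin K → ℝ := fun k =>
    -(ρ * inner ℝ (M - ν k) (x - ν k)) - ρ ^ 2 * ‖ν k - M‖ ^ 2 / 2 with he
  have hk : ∀ k, gaussDens (x + ρ • M - (1 + ρ) • ν k) =
      gaussDens (x - ν k) * Real.exp (e k) := by
    intro k
    unfold gaussDens
    rw [mul_assoc, ← Real.exp_add]
    congr 2
    rw [show x + ρ • M - (1 + ρ) • ν k = (x - ν k) + ρ • (M - ν k) by
      rw [smul_sub, add_smul, one_smul]; abel, norm_add_sq_real, norm_smul, mul_pow,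
      real_inner_smul_right, Real.norm_eq_abs, sq_abs, he]
    simp only []
    rw [real_inner_comm, norm_sub_rev (ν k) M]
    ring
  have hR : mixDens π (fun k => (1 + ρ) • ν k) (x + ρ • M) =
      mixDens π ν x * ∑ k, post π ν x k * Real.exp (e k) := by
    rw [Finset.mul_sum]
    unfold mixDens
    refine Finset.sum_congr rfl fun k _ => ?_
    rw [hk, ← mul_assoc, ← mul_assoc]
    congr 1
    exact (mixDens_mul_post hπ h1 ν x k).symm
  rw [hR]
  refine mul_le_mul_of_nonneg_left ?_ (mixDens_pos hπ h1 ν x).le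
  have hJ := convexOn_exp.map_sum_le (t := Finset.univ) (w := post π ν x) (p := e)
    (fun k _ => post_nonneg hπ h1 ν x k) (sum_post hπ h1 ν x) (fun _ _ => Set.mem_univ _)
  simp only [smul_eq_mul] at hJ
  refine le_trans (Real.exp_le_exp.2 (le_of_eq ?_)) hJ
  -- the deviations have mean zero, so only `M - ν k` survives from `x - ν k`
  have h0 := congrArg (fun w => (inner ℝ w (M - x) : ℝ)) (sum_post_smul_sub hπ h1 ν x)
  simp only [sum_inner, real_inner_smul_left, inner_zero_left] at h0
  have hek : ∀ k, post π ν x k * e k = -ρ * (post π ν x k * inner ℝ (ν k - M) (M - x)) -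
      (ρ + ρ ^ 2 / 2) * (post π ν x k * ‖ν k - M‖ ^ 2) := by
    intro k
    rw [he]
    simp only []
    rw [show x - ν k = -(M - x) - (ν k - M) by abel, show M - ν k = -(ν k - M) by abel,
      inner_sub_right, inner_neg_left, inner_neg_left, inner_neg_right,
      real_inner_self_eq_norm_sq]
    ring
  simp_rw [hek]
  rw [Finset.sum_sub_distrib, ← Finset.mul_sum, ← Finset.mul_sum, h0, postVar]
  ring

/-- The Jacobian gain and the density loss of the Euler map cancel to first order. -/
lemma mixDens_le_det_mul_mixDens_add (x : 𝔼^d) {ρ : ℝ} (hρ : 0 ≤ ρ) :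
    mixDens π ν x ≤ |(1 + ρ • postCov π ν x : 𝔼^d →L[ℝ] 𝔼^d).det| *
        mixDens π (fun k => (1 + ρ) • ν k) (x + ρ • postMean π ν x) +
      mixDens π ν x * (ρ ^ 2 * (postVar π ν x ^ 2 + postVar π ν x)) := by
  set V := postVar π ν x with hV
  have hV0 : 0 ≤ V := postVar_nonneg hπ h1 ν x
  have hp := mixDens_pos hπ h1 ν x
  have hdet := one_add_le_det hπ h1 ν x hρ
  have hmix := mixDens_mul_exp_le hπ h1 ν ρ x
  rw [← hV] at hdet hmix
  have hu : 0 ≤ ρ * V := mul_nonneg hρ hV0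
  set X := Real.exp (-(ρ * V) - ρ ^ 2 * V / 2)
  have hkey : 1 - ρ ^ 2 * (V ^ 2 + V) ≤ (1 + ρ * V) * X := by
    -- `(1 + u) e^{-u} ≥ 1 - u²` and `e^{-v} ≥ 1 - v`
    have hXe : X = Real.exp (-(ρ * V)) * Real.exp (-(ρ ^ 2 * V / 2)) := by
      rw [← Real.exp_add]; congr 1
    have ha : 1 - (ρ * V) ^ 2 ≤ (1 + ρ * V) * Real.exp (-(ρ * V)) := by
      nlinarith [Real.add_one_le_exp (-(ρ * V))]
    have hb : (1 + ρ * V) * Real.exp (-(ρ * V)) ≤ 1 := by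
      rw [Real.exp_neg, ← div_eq_mul_inv, div_le_one (Real.exp_pos _)]
      linarith [Real.add_one_le_exp (ρ * V)]
    have hc := Real.add_one_le_exp (-(ρ ^ 2 * V / 2))
    have hv : 0 ≤ ρ ^ 2 * V := by positivity
    have hw : 0 ≤ (1 + ρ * V) * Real.exp (-(ρ * V)) := by positivity
    rw [hXe, ← mul_assoc]
    nlinarith
  have h2 : (1 + ρ * V) * (mixDens π ν x * X) ≤ |(1 + ρ • postCov π ν x : 𝔼^d →L[ℝ] 𝔼^d).det| *
        mixDens π (fun k => (1 + ρ) • ν k) (x + ρ • postMean π ν x) := by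
    refine mul_le_mul (hdet.trans (le_abs_self _)) hmix (by positivity) (abs_nonneg _)
  nlinarith

/-- One Euler step for the probability flow moves a mixture to the mixture with dilated centres,
up to an error quadratic in the step size. -/
lemma lintegral_comp_add_smul_postMean_le {ρ : ℝ} (hρ : 0 ≤ ρ) {H : 𝔼^d → ℝ≥0∞} (hH : Measurable H)
    {lam : ℝ≥0∞} (hlam : ∀ x, H x ≤ lam) :
    ∫⁻ x, H (x + ρ • postMean π ν x) ∂gmm π ν ≤
      ∫⁻ x, H x ∂gmm π (fun k => (1 + ρ) • ν k) +
        lam * ∫⁻ x, ENNReal.ofReal (ρ ^ 2 * (postVar π ν x ^ 2 + postVar π ν x)) ∂gmm π ν := by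
  have hc1 := continuous_postMean hπ h1 ν
  have hc2 := continuous_postVar hπ h1 ν
  have hφ : Measurable fun x => x + ρ • postMean π ν x :=
    (continuous_id.add (hc1.const_smul ρ)).measurable
  have hπ0 : ∀ k, 0 ≤ π k := fun k => (hπ k).le
  have herr : Measurable fun x =>
      ENNReal.ofReal (ρ ^ 2 * (postVar π ν x ^ 2 + postVar π ν x)) :=
    (continuous_const.mul ((hc2.pow 2).add hc2)).measurable.ennreal_ofReal
  rw [gmm_eq_withDensity hπ0, gmm_eq_withDensity hπ0,
    lintegral_withDensity_eq_lintegral_mul _ (by fun_prop)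
      (show Measurable fun x => H (x + ρ • postMean π ν x) from hH.comp hφ),
    lintegral_withDensity_eq_lintegral_mul _ (by fun_prop) hH,
    lintegral_withDensity_eq_lintegral_mul _ (by fun_prop) herr]
  simp only [Pi.mul_apply]
  have hcv := lintegral_image_eq_lintegral_abs_det_fderiv_mul volume MeasurableSet.univ
    (fun x _ => (hasFDerivAt_add_smul_postMean hπ h1 ν ρ x).hasFDerivWithinAt)
    ((injective_add_smul_postMean hπ h1 ν hρ).injOn)
    (fun y => ENNReal.ofReal (mixDens π (fun k => (1 + ρ) • ν k) y) * H y)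
  rw [Measure.restrict_univ] at hcv
  have hle := hcv.symm.le.trans (setLIntegral_le_lintegral _ _)
  have hm : Measurable fun x => ENNReal.ofReal (mixDens π ν x) *
      ENNReal.ofReal (ρ ^ 2 * (postVar π ν x ^ 2 + postVar π ν x)) :=
    ((continuous_mixDens π ν).measurable.ennreal_ofReal).mul herr
  rw [← lintegral_const_mul _ hm]
  refine le_trans ?_ (add_le_add_left hle _)
  rw [← lintegral_add_right _ (hm.const_mul lam)]
  refine lintegral_mono fun x => ?_
  have hx := mixDens_le_det_mul_mixDens_add hπ h1 ν x hρ
  have hp := mixDens_nonneg hπ0 ν x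
  have hp' := mixDens_nonneg hπ0 (fun k => (1 + ρ) • ν k) (x + ρ • postMean π ν x)
  have hV := postVar_nonneg hπ h1 ν x
  have hx' := ENNReal.ofReal_le_ofReal hx
  rw [ENNReal.ofReal_add (by positivity) (by positivity), ENNReal.ofReal_mul (abs_nonneg _),
    ENNReal.ofReal_mul hp] at hx'
  refine (mul_le_mul_left hx' _).trans ?_
  rw [add_mul, mul_assoc]
  refine add_le_add_right ?_ _
  rw [mul_comm]
  exact mul_le_mul_left (hlam _) _

end Euler

/-! ### Moments of the posterior variance and of the score -/

section Moments

variable {π : Fin K → ℝ} (hπ : ∀ k, 0 < π k) (h1 : ∑ k, π k = 1) (ν : Fin K → 𝔼^d)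
include hπ h1

/-- The squared posterior variance is at most the fourth moment of the distance between two
independent draws from the posterior. -/
lemma sq_postVar_le (x : 𝔼^d) :
    postVar π ν x ^ 2 ≤ ∑ i, ∑ j, post π ν x i * post π ν x j * (‖ν i - ν j‖ ^ 2) ^ 2 := by
  set M := postMean π ν x with hM
  have hw := post_nonneg hπ h1 ν x
  have hs := sum_post hπ h1 ν x
  have hA := (even_two.convexOn_pow (𝕜 := ℝ)).map_sum_le (t := Finset.univ) (w := post π ν x)
    (p := fun k => ‖ν k - M‖ ^ 2) (fun k _ => hw k) hs (fun _ _ => Set.mem_univ _)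
  simp only [smul_eq_mul] at hA
  refine hA.trans (Finset.sum_le_sum fun i _ => ?_)
  simp_rw [mul_assoc]
  rw [← Finset.mul_sum]
  refine mul_le_mul_of_nonneg_left ?_ (hw i)
  have hB := ((convexOn_norm (E := 𝔼^d) convex_univ).pow (fun _ _ => norm_nonneg _) 4).map_sum_le
    (t := Finset.univ) (w := post π ν x) (p := fun j => ν i - ν j) (fun k _ => hw k) hs
    (fun _ _ => Set.mem_univ _)
  have hd : ∑ j, post π ν x j • (ν i - ν j) = ν i - M := by
    simp only [smul_sub, Finset.sum_sub_distrib, ← Finset.sum_smul, hs, one_smul]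
    rfl
  rw [hd] at hB
  simp only [smul_eq_mul, Pi.pow_apply] at hB
  simp only [← pow_mul]
  exact hB

/-- Two components are simultaneously plausible only near their midpoint, and the weight of this
event is Gaussian in their distance. -/
lemma mixDens_mul_post_mul_post_le (x : 𝔼^d) (i j : Fin K) :
    mixDens π ν x * (post π ν x i * post π ν x j) ≤
      √(π i) * √(π j) * Real.exp (-‖ν i - ν j‖ ^ 2 / 8) *
        gaussDens (x - (1 / 2 : ℝ) • (ν i + ν j)) := by
  have hp := mixDens_pos hπ h1 ν x
  set p := mixDens π ν x with hpd
  set a := π i * gaussDens (x - ν i) with ha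
  set b := π j * gaussDens (x - ν j) with hb
  have ha0 : 0 < a := mul_pos (hπ i) (gaussDens_pos _)
  have hb0 : 0 < b := mul_pos (hπ j) (gaussDens_pos _)
  have hle : ∀ k, π k * gaussDens (x - ν k) ≤ p := fun k =>
    Finset.single_le_sum (f := fun k => π k * gaussDens (x - ν k))
      (fun k _ => mul_nonneg (hπ k).le (gaussDens_pos _).le) (Finset.mem_univ k)
  have hpi : post π ν x i = a / p := rfl
  have hpj : post π ν x j = b / p := rfl
  have hgg : gaussDens (x - ν i) * gaussDens (x - ν j) =
      (Real.exp (-‖ν i - ν j‖ ^ 2 / 8) * gaussDens (x - (1 / 2 : ℝ) • (ν i + ν j))) ^ 2 := by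
    set u := x - (1 / 2 : ℝ) • (ν i + ν j) with hu
    set v := (1 / 2 : ℝ) • (ν i - ν j) with hv
    have e1 : x - ν i = u - v := by rw [hu, hv]; module
    have e2 : x - ν j = u + v := by rw [hu, hv]; module
    have e3 : ‖ν i - ν j‖ ^ 2 = 4 * ‖v‖ ^ 2 := by
      rw [hv, norm_smul, mul_pow]; norm_num; ring
    rw [e1, e2, e3]
    unfold gaussDens
    have e4 : Real.exp (-‖u - v‖ ^ 2 / 2) * Real.exp (-‖u + v‖ ^ 2 / 2) =
        (Real.exp (-(4 * ‖v‖ ^ 2) / 8) * Real.exp (-‖u‖ ^ 2 / 2)) ^ 2 := by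
      rw [← Real.exp_add, ← Real.exp_add, ← Real.exp_nat_mul]
      congr 1
      rw [norm_sub_sq_real, norm_add_sq_real]
      push_cast
      ring
    linear_combination (((2 * Real.pi) ^ (d / 2 : ℝ))⁻¹) ^ 2 * e4
  refine (le_abs_self _).trans (abs_le_of_sq_le_sq ?_ ?_)
  · have hr : (√(π i) * √(π j) * Real.exp (-‖ν i - ν j‖ ^ 2 / 8) *
        gaussDens (x - (1 / 2 : ℝ) • (ν i + ν j))) ^ 2 = a * b := by
      rw [mul_assoc, mul_pow, ← hgg, mul_pow, Real.sq_sqrt (hπ i).le, Real.sq_sqrt (hπ j).le,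
        ha, hb]
      ring
    rw [hr, hpi, hpj]
    have e : (p * (a / p * (b / p))) ^ 2 = a * b * (a / p * (b / p)) := by
      field_simp
    rw [e]
    have h3 : a / p ≤ 1 := (div_le_one hp).2 (hle i)
    have h4 : b / p ≤ 1 := (div_le_one hp).2 (hle j)
    have h5 : a / p * (b / p) ≤ 1 := mul_le_one₀ h3 (by positivity) h4
    nlinarith
  · have := gaussDens_pos (x - (1 / 2 : ℝ) • (ν i + ν j))
    positivity

/-- Pointwise form of the second moment bound for the posterior variance: pairs of centres at
squared distance above `16 log K` contribute at most `512 / K` each. -/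
lemma mixDens_mul_sq_postVar_le (hK : 1 ≤ K) (x : 𝔼^d) :
    mixDens π ν x * postVar π ν x ^ 2 ≤ 256 * Real.log K ^ 2 * mixDens π ν x +
      ∑ i, ∑ j, 512 / K * (√(π i) * √(π j)) * gaussDens (x - (1 / 2 : ℝ) • (ν i + ν j)) := by
  have hp := mixDens_pos hπ h1 ν x
  have hw := post_nonneg hπ h1 ν x
  have hs := sum_post hπ h1 ν x
  have hK0 : (0 : ℝ) < K := by exact_mod_cast hK
  have hsum : 256 * Real.log K ^ 2 * mixDens π ν x = ∑ i, ∑ j, 256 * Real.log K ^ 2 *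
      (mixDens π ν x * (post π ν x i * post π ν x j)) := by
    simp_rw [← Finset.mul_sum, hs, mul_one, hs, mul_one]
  refine (mul_le_mul_of_nonneg_left (sq_postVar_le hπ h1 ν x) hp.le).trans ?_
  rw [hsum, ← Finset.sum_add_distrib, Finset.mul_sum]
  refine Finset.sum_le_sum fun i _ => ?_
  rw [← Finset.sum_add_distrib, Finset.mul_sum]
  refine Finset.sum_le_sum fun j _ => ?_
  set s := ‖ν i - ν j‖ ^ 2 with hsd
  have hpw : 0 ≤ mixDens π ν x * (post π ν x i * post π ν x j) :=
    mul_nonneg hp.le (mul_nonneg (hw i) (hw j))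
  have hg := gaussDens_pos (x - (1 / 2 : ℝ) • (ν i + ν j))
  rw [← mul_assoc]
  rcases le_or_gt s (16 * Real.log K) with h | h
  · have h2 : s ^ 2 ≤ 256 * Real.log K ^ 2 := by nlinarith
    have h3 : 0 ≤ 512 / K * (√(π i) * √(π j)) * gaussDens (x - (1 / 2 : ℝ) • (ν i + ν j)) := by
      positivity
    nlinarith
  · have h2 : Real.exp (-s / 8) * s ^ 2 ≤ 512 / K := by
      have e1 : s ^ 2 ≤ 512 * Real.exp (s / 16) := by
        have := Real.quadratic_le_exp_of_nonneg (x := s / 16) (by positivity)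
        nlinarith
      have e2 : Real.exp (-s / 16) ≤ 1 / K := by
        rw [one_div, ← Real.exp_log hK0, ← Real.exp_neg]
        exact Real.exp_le_exp.2 (by linarith)
      have e3 : Real.exp (-s / 8) * Real.exp (s / 16) = Real.exp (-s / 16) := by
        rw [← Real.exp_add]; congr 1; ring
      calc Real.exp (-s / 8) * s ^ 2 ≤ Real.exp (-s / 8) * (512 * Real.exp (s / 16)) :=
            mul_le_mul_of_nonneg_left e1 (Real.exp_pos _).le
        _ = 512 * Real.exp (-s / 16) := by rw [← e3]; ring
        _ ≤ 512 * (1 / K) := by linarith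
        _ = 512 / K := by ring
    have h3 := mixDens_mul_post_mul_post_le hπ h1 ν x i j
    have h4 : 0 ≤ 256 * Real.log K ^ 2 * (mixDens π ν x * (post π ν x i * post π ν x j)) := by
      positivity
    refine le_trans ?_ (le_add_of_nonneg_left h4)
    calc mixDens π ν x * (post π ν x i * post π ν x j) * s ^ 2
        ≤ √(π i) * √(π j) * Real.exp (-s / 8) *
            gaussDens (x - (1 / 2 : ℝ) • (ν i + ν j)) * s ^ 2 :=
          mul_le_mul_of_nonneg_right h3 (by positivity)
      _ = (√(π i) * √(π j) * gaussDens (x - (1 / 2 : ℝ) • (ν i + ν j))) *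
            (Real.exp (-s / 8) * s ^ 2) := by ring
      _ ≤ (√(π i) * √(π j) * gaussDens (x - (1 / 2 : ℝ) • (ν i + ν j))) * (512 / K) :=
          mul_le_mul_of_nonneg_left h2 (by positivity)
      _ = _ := by ring

omit hπ h1 in
lemma integral_gaussDens_sub (m : 𝔼^d) : ∫ x, gaussDens (x - m) = 1 := by
  rw [integral_sub_right_eq_self (fun x => gaussDens x) m, integral_gaussDens]

omit hπ h1 in
lemma integrable_gaussDens_sub (m : 𝔼^d) : Integrable fun x => gaussDens (x - m) :=
  integrable_gaussDens.comp_sub_right m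

omit hπ h1 in
lemma integrable_mixDens : Integrable (mixDens π ν) := by
  unfold mixDens
  exact integrable_finsetSum _ fun k _ => (integrable_gaussDens_sub (ν k)).const_mul _

omit hπ in
lemma integral_mixDens : ∫ x, mixDens π ν x = 1 := by
  unfold mixDens
  rw [integral_finsetSum _ fun k _ => (integrable_gaussDens_sub (ν k)).const_mul _]
  simp_rw [integral_const_mul, integral_gaussDens_sub, mul_one]
  exact h1

/-- The posterior variance has a second moment of order `log² K`, in every dimension. -/
lemma lintegral_sq_postVar_le (hK : 1 ≤ K) :
    ∫⁻ x, ENNReal.ofReal (postVar π ν x ^ 2) ∂gmm π ν ≤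
      ENNReal.ofReal (256 * Real.log K ^ 2 + 512) := by
  have hc := continuous_postVar hπ h1 ν
  rw [gmm_eq_withDensity fun k => (hπ k).le,
    lintegral_withDensity_eq_lintegral_mul _ (by fun_prop) (by fun_prop)]
  simp only [Pi.mul_apply]
  have hint : ∀ i j, Integrable fun x : 𝔼^d =>
      512 / (K : ℝ) * (√(π i) * √(π j)) * gaussDens (x - (1 / 2 : ℝ) • (ν i + ν j)) :=
    fun i j => (integrable_gaussDens_sub _).const_mul _
  have hi1 : Integrable fun x : 𝔼^d => 256 * Real.log K ^ 2 * mixDens π ν x :=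
    (integrable_mixDens ν).const_mul _
  have hi2 : Integrable fun x : 𝔼^d => ∑ i, ∑ j,
      512 / (K : ℝ) * (√(π i) * √(π j)) * gaussDens (x - (1 / 2 : ℝ) • (ν i + ν j)) :=
    integrable_finsetSum _ fun i _ => integrable_finsetSum _ fun j _ => hint i j
  calc ∫⁻ x, ENNReal.ofReal (mixDens π ν x) * ENNReal.ofReal (postVar π ν x ^ 2)
      ≤ ∫⁻ x, ENNReal.ofReal (256 * Real.log K ^ 2 * mixDens π ν x + ∑ i, ∑ j,
          512 / K * (√(π i) * √(π j)) * gaussDens (x - (1 / 2 : ℝ) • (ν i + ν j))) := by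
        refine lintegral_mono fun x => ?_
        rw [← ENNReal.ofReal_mul (mixDens_pos hπ h1 ν x).le]
        exact ENNReal.ofReal_le_ofReal (mixDens_mul_sq_postVar_le hπ h1 ν hK x)
    _ = ENNReal.ofReal (∫ x, (256 * Real.log K ^ 2 * mixDens π ν x + ∑ i, ∑ j,
          512 / K * (√(π i) * √(π j)) * gaussDens (x - (1 / 2 : ℝ) • (ν i + ν j)))) := by
        refine (ofReal_integral_eq_lintegral_ofReal (hi1.add hi2)
          (Filter.Eventually.of_forall fun x => ?_)).symm
        exact add_nonneg (mul_nonneg (by positivity) (mixDens_pos hπ h1 ν x).le)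
          (Finset.sum_nonneg fun i _ => Finset.sum_nonneg fun j _ =>
            mul_nonneg (by positivity) (gaussDens_pos _).le)
    _ ≤ ENNReal.ofReal (256 * Real.log K ^ 2 + 512) := by
        refine ENNReal.ofReal_le_ofReal ?_
        rw [integral_add hi1 hi2, integral_const_mul, integral_mixDens h1,
          integral_finsetSum _ fun i _ => integrable_finsetSum _ fun j _ => hint i j]
        simp_rw [fun i => integral_finsetSum Finset.univ fun j _ => hint i j, integral_const_mul,
          integral_gaussDens_sub, mul_one, ← Finset.mul_sum, ← Finset.sum_mul]
        have hK0 : (0 : ℝ) < K := by exact_mod_cast hK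
        have hcs := sq_sum_le_card_mul_sum_sq (s := Finset.univ) (f := fun k => √(π k))
        simp only [Real.sq_sqrt (hπ _).le, h1, Finset.card_univ, Fintype.card_fin, mul_one] at hcs
        have : 512 / (K : ℝ) * ((∑ i, √(π i)) * ∑ i, √(π i)) ≤ 512 := by
          rw [← sq, div_mul_eq_mul_div, div_le_iff₀ hK0]
          linarith
        linarith

/-- The expected error of one Euler step. -/
lemma lintegral_euler_error_le (hK : 1 ≤ K) (ρ : ℝ) :
    ∫⁻ x, ENNReal.ofReal (ρ ^ 2 * (postVar π ν x ^ 2 + postVar π ν x)) ∂gmm π ν ≤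
      ENNReal.ofReal (ρ ^ 2 * (512 * Real.log K ^ 2 + 1025)) := by
  have hc := continuous_postVar hπ h1 ν
  have hprob := isProbabilityMeasure_gmm (fun k => (hπ k).le) h1 ν
  calc ∫⁻ x, ENNReal.ofReal (ρ ^ 2 * (postVar π ν x ^ 2 + postVar π ν x)) ∂gmm π ν
      ≤ ∫⁻ x, (ENNReal.ofReal (2 * ρ ^ 2) * ENNReal.ofReal (postVar π ν x ^ 2) +
          ENNReal.ofReal (ρ ^ 2)) ∂gmm π ν := by
        refine lintegral_mono fun x => ?_
        rw [← ENNReal.ofReal_mul (by positivity), ← ENNReal.ofReal_add (by positivity)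
          (by positivity)]
        refine ENNReal.ofReal_le_ofReal ?_
        have h : postVar π ν x ^ 2 + postVar π ν x ≤ 2 * postVar π ν x ^ 2 + 1 := by
          nlinarith [sq_nonneg (2 * postVar π ν x - 1)]
        nlinarith [mul_le_mul_of_nonneg_left h (sq_nonneg ρ)]
    _ = ENNReal.ofReal (2 * ρ ^ 2) * ∫⁻ x, ENNReal.ofReal (postVar π ν x ^ 2) ∂gmm π ν +
          ENNReal.ofReal (ρ ^ 2) := by
        rw [lintegral_add_right _ measurable_const, lintegral_const_mul _ (by fun_prop)]
        simp
    _ ≤ ENNReal.ofReal (2 * ρ ^ 2) * ENNReal.ofReal (256 * Real.log K ^ 2 + 512) +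
          ENNReal.ofReal (ρ ^ 2) := by
        gcongr
        exact lintegral_sq_postVar_le hπ h1 ν hK
    _ = ENNReal.ofReal (ρ ^ 2 * (512 * Real.log K ^ 2 + 1025)) := by
        rw [← ENNReal.ofReal_mul (by positivity), ← ENNReal.ofReal_add (by positivity)
          (by positivity)]
        congr 1; ring

omit hπ h1 in
lemma lintegral_exp_sq_norm_stdGaussian :
    ∫⁻ z, ENNReal.ofReal (Real.exp (‖z‖ ^ 2 / 4)) ∂stdGaussian 𝔼^d =
      ENNReal.ofReal (2 ^ (d / 2 : ℝ)) := by
  rw [lintegral_stdGaussian (by fun_prop)]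
  have h : ∀ z : 𝔼^d, ENNReal.ofReal (gaussDens z) * ENNReal.ofReal (Real.exp (‖z‖ ^ 2 / 4)) =
      ENNReal.ofReal (((2 * Real.pi) ^ (d / 2 : ℝ))⁻¹ * Real.exp (-(1 / 4) * ‖z‖ ^ 2)) := by
    intro z
    rw [← ENNReal.ofReal_mul (gaussDens_pos z).le, gaussDens, mul_assoc, ← Real.exp_add]
    congr 3; ring
  simp_rw [h]
  rw [← ofReal_integral_eq_lintegral_ofReal
    ((integrable_exp_neg_mul_sq_norm (by norm_num)).const_mul _)
    (Filter.Eventually.of_forall fun z => by positivity), integral_const_mul,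
    GaussianFourier.integral_rexp_neg_mul_sq_norm (by norm_num)]
  congr 1
  have hrpow : (2 * (2 * Real.pi)) ^ (d / 2 : ℝ) = 2 ^ (d / 2 : ℝ) * (2 * Real.pi) ^ (d / 2 : ℝ) :=
    Real.mul_rpow (by norm_num) (by positivity)
  rw [show Real.pi / (1 / 4) = 2 * (2 * Real.pi) by ring]
  simp only [finrank_euclideanSpace, Fintype.card_fin]
  rw [hrpow, mul_left_comm, inv_mul_cancel₀ (by positivity), mul_one]

/-- The score is a conditional expectation of Gaussian noise, so it inherits an exponential
moment from it. -/
lemma lintegral_exp_sq_norm_score_le :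
    ∫⁻ x, ENNReal.ofReal (Real.exp (‖postMean π ν x - x‖ ^ 2 / 4)) ∂gmm π ν ≤
      ENNReal.ofReal (2 ^ (d / 2 : ℝ)) := by
  have hc := continuous_postMean hπ h1 ν
  have hπ0 : ∀ k, 0 ≤ π k := fun k => (hπ k).le
  rw [gmm_eq_withDensity hπ0,
    lintegral_withDensity_eq_lintegral_mul _ (by fun_prop) (by fun_prop)]
  simp only [Pi.mul_apply]
  calc ∫⁻ x, ENNReal.ofReal (mixDens π ν x) *
        ENNReal.ofReal (Real.exp (‖postMean π ν x - x‖ ^ 2 / 4))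
      ≤ ∫⁻ x, ∑ k, ENNReal.ofReal (π k) * (ENNReal.ofReal (gaussDens (x - ν k)) *
          ENNReal.ofReal (Real.exp (‖x - ν k‖ ^ 2 / 4))) := by
        refine lintegral_mono fun x => ?_
        have hw := post_nonneg hπ h1 ν x
        have hs := sum_post hπ h1 ν x
        have hp := mixDens_pos hπ h1 ν x
        have hJ1 := ((convexOn_norm (E := 𝔼^d) convex_univ).pow
          (fun _ _ => norm_nonneg _) 2).map_sum_le (t := Finset.univ) (w := post π ν x)
          (p := fun k => ν k - x) (fun k _ => hw k) hs (fun _ _ => Set.mem_univ _)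
        have hd : ∑ k, post π ν x k • (ν k - x) = postMean π ν x - x := by
          simp only [smul_sub, Finset.sum_sub_distrib, ← Finset.sum_smul, hs, one_smul]
          rfl
        rw [hd] at hJ1
        simp only [smul_eq_mul, Pi.pow_apply] at hJ1
        have hJ2 := convexOn_exp.map_sum_le (t := Finset.univ) (w := post π ν x)
          (p := fun k => ‖ν k - x‖ ^ 2 / 4) (fun k _ => hw k) hs (fun _ _ => Set.mem_univ _)
        simp only [smul_eq_mul] at hJ2
        have hJ : Real.exp (‖postMean π ν x - x‖ ^ 2 / 4) ≤
            ∑ k, post π ν x k * Real.exp (‖ν k - x‖ ^ 2 / 4) := by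
          refine (Real.exp_le_exp.2 ?_).trans hJ2
          simp_rw [← mul_div_assoc, ← Finset.sum_div]
          linarith
        simp_rw [← ENNReal.ofReal_mul (gaussDens_pos _).le, ← ENNReal.ofReal_mul (hπ0 _)]
        rw [← ENNReal.ofReal_mul hp.le, ← ENNReal.ofReal_sum_of_nonneg fun k _ =>
          mul_nonneg (hπ0 k) (mul_nonneg (gaussDens_pos _).le (Real.exp_pos _).le)]
        refine ENNReal.ofReal_le_ofReal ((mul_le_mul_of_nonneg_left hJ hp.le).trans (le_of_eq ?_))
        rw [Finset.mul_sum]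
        refine Finset.sum_congr rfl fun k _ => ?_
        rw [← mul_assoc, mixDens_mul_post hπ h1, norm_sub_rev, mul_assoc]
    _ = ∑ k, ENNReal.ofReal (π k) * ENNReal.ofReal (2 ^ (d / 2 : ℝ)) := by
        rw [lintegral_finsetSum _ (by fun_prop)]
        refine Finset.sum_congr rfl fun k _ => ?_
        rw [lintegral_const_mul _ (by fun_prop), lintegral_sub_right_eq_self (fun x =>
          ENNReal.ofReal (gaussDens x) * ENNReal.ofReal (Real.exp (‖x‖ ^ 2 / 4))) (ν k),
          ← lintegral_stdGaussian (by fun_prop), lintegral_exp_sq_norm_stdGaussian]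
    _ = ENNReal.ofReal (2 ^ (d / 2 : ℝ)) := by
        rw [← Finset.sum_mul, ← ENNReal.ofReal_sum_of_nonneg fun k _ => hπ0 k, h1,
          ENNReal.ofReal_one, one_mul]

end Moments

/-! ### The effect of truncating the score -/

/-- Truncation at level `R` increases the squared error only where the target exceeds `R / 2`;
there the excess is at most `8 exp (‖w‖² / 4 - R² / 32)`. -/
lemma sq_norm_clip_sub_le {R : ℝ} (hR : 0 ≤ R) (v w : 𝔼^d) :
    ‖clip R v - w‖ ^ 2 ≤ ‖v - w‖ ^ 2 + 8 * Real.exp (-R ^ 2 / 32) * Real.exp (‖w‖ ^ 2 / 4) := by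
  have hpos : 0 ≤ 8 * Real.exp (-R ^ 2 / 32) * Real.exp (‖w‖ ^ 2 / 4) := by positivity
  unfold clip
  split_ifs with h
  · linarith
  · rw [zero_sub, norm_neg]
    rcases le_or_gt ‖w‖ (R / 2) with hw | hw
    · have h2 : ‖v‖ - ‖w‖ ≤ ‖v - w‖ := norm_sub_norm_le v w
      have h3 : ‖w‖ ≤ ‖v - w‖ := by linarith
      have := pow_le_pow_left₀ (norm_nonneg w) h3 2
      linarith
    · have h2 : R ^ 2 / 4 ≤ ‖w‖ ^ 2 := by nlinarith
      have h3 : ‖w‖ ^ 2 ≤ 8 * Real.exp (‖w‖ ^ 2 / 8) := by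
        have := Real.add_one_le_exp (‖w‖ ^ 2 / 8)
        linarith
      have h4 : Real.exp (‖w‖ ^ 2 / 8) ≤ Real.exp (-R ^ 2 / 32) * Real.exp (‖w‖ ^ 2 / 4) := by
        rw [← Real.exp_add]
        exact Real.exp_le_exp.2 (by linarith)
      have := sq_nonneg ‖v - w‖
      linarith

lemma measurable_clip (R : ℝ) : Measurable (clip R : 𝔼^d → 𝔼^d) := by
  unfold clip
  exact Measurable.ite (measurableSet_le measurable_norm measurable_const) measurable_id
    measurable_const

/-- The mean squared error of a truncated score estimate. -/
lemma lintegral_clip_sub_score_le {π : Fin K → ℝ} (hπ : ∀ k, 0 < π k) (h1 : ∑ k, π k = 1)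
    (ν : Fin K → 𝔼^d) {R : ℝ} (hR : 0 ≤ R) (s : 𝔼^d → 𝔼^d) :
    ∫⁻ x, ENNReal.ofReal (‖clip R (s x) - (postMean π ν x - x)‖ ^ 2) ∂gmm π ν ≤
      scoreError (gmm π ν) s +
        ENNReal.ofReal (8 * Real.exp (-R ^ 2 / 32) * 2 ^ (d / 2 : ℝ)) := by
  have hc := continuous_postMean hπ h1 ν
  have hA : 0 ≤ 8 * Real.exp (-R ^ 2 / 32) := by positivity
  calc _ ≤ ∫⁻ x, (‖s x - score (gmm π ν) x‖ₑ ^ 2 + ENNReal.ofReal (8 * Real.exp (-R ^ 2 / 32)) *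
          ENNReal.ofReal (Real.exp (‖postMean π ν x - x‖ ^ 2 / 4))) ∂gmm π ν := by
        refine lintegral_mono fun x => ?_
        rw [score_gmm hπ h1, ← ofReal_norm, ← ENNReal.ofReal_pow (norm_nonneg _),
          ← ENNReal.ofReal_mul hA, ← ENNReal.ofReal_add (by positivity) (by positivity)]
        exact ENNReal.ofReal_le_ofReal (sq_norm_clip_sub_le hR _ _)
    _ ≤ _ := by
        rw [lintegral_add_right _ (by fun_prop), lintegral_const_mul _ (by fun_prop),
          ENNReal.ofReal_mul hA]
        unfold scoreError
        gcongr
        exact lintegral_exp_sq_norm_score_le hπ h1 ν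

/-! ### A dual form of relative entropy bounds, up to total variation -/

/-- `P` is within relative entropy `D` of `Q` up to total variation `δ`, expressed through the
Donsker–Varadhan duality: testing against all functions with values in `[0, lam]`. Unlike the
relative entropy itself, this relation tolerates replacing `P` by a measure close to it in total
variation. -/
def EntropyTVBound {Ω : Type*} [MeasurableSpace Ω] (P Q : Measure Ω) (D δ : ℝ) : Prop :=
  ∀ (lam : ℝ) (g : Ω → ℝ), Measurable g → (∀ x, 0 ≤ g x) → (∀ x, g x ≤ lam) →
    ∫ x, g x ∂P ≤ ∫ x, (Real.exp (g x) - 1) ∂Q + D + lam * δ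

/-- A Pinsker-type inequality for `EntropyTVBound`, from testing against `√D` times an
indicator. -/
lemma EntropyTVBound.measureReal_sub_le {Ω : Type*} [MeasurableSpace Ω] {P Q : Measure Ω}
    [IsProbabilityMeasure P] [IsProbabilityMeasure Q] {D δ : ℝ} (h : EntropyTVBound P Q D δ)
    (hD : 0 < D) (hδ : 0 ≤ δ) {A : Set Ω} (hA : MeasurableSet A) :
    P.real A - Q.real A ≤ 2 * √D + δ := by
  have hP : P.real A ≤ 1 := measureReal_le_one
  have hQ0 : 0 ≤ Q.real A := measureReal_nonneg
  have hs : 0 < √D := Real.sqrt_pos.2 hD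
  rcases le_or_gt √D 1 with h1 | h1
  · have := h √D (A.indicator fun _ => √D) (measurable_const.indicator hA)
      (fun x => Set.indicator_nonneg (fun _ _ => hs.le) x)
      (fun x => Set.indicator_le_self' (fun _ _ => hs.le) x)
    have he : (fun x => Real.exp (A.indicator (fun _ => √D) x) - 1) =
        A.indicator fun _ => Real.exp √D - 1 := by
      ext x
      by_cases hx : x ∈ A <;> simp [hx]
    rw [he, integral_indicator_const _ hA, integral_indicator_const _ hA, smul_eq_mul,
      smul_eq_mul] at this
    have hexp : Real.exp √D - 1 ≤ √D + √D ^ 2 := by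
      have := (abs_le.1 (Real.abs_exp_sub_one_sub_id_le (x := √D) (by rwa [abs_of_pos hs]))).2
      linarith
    have hDs : √D ^ 2 = D := Real.sq_sqrt hD.le
    have h2 : √D * (P.real A - Q.real A) ≤ √D * (2 * √D + δ) := by
      nlinarith [mul_le_mul_of_nonneg_left hexp hQ0]
    exact le_of_mul_le_mul_left h2 hs
  · linarith

lemma EntropyTVBound.abs_measureReal_sub_le {Ω : Type*} [MeasurableSpace Ω] {P Q : Measure Ω}
    [IsProbabilityMeasure P] [IsProbabilityMeasure Q] {D δ : ℝ} (h : EntropyTVBound P Q D δ)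
    (hD : 0 < D) (hδ : 0 ≤ δ) {A : Set Ω} (hA : MeasurableSet A) :
    |P.real A - Q.real A| ≤ 2 * √D + δ := by
  have h1 := h.measureReal_sub_le hD hδ hA
  have h2 := h.measureReal_sub_le hD hδ hA.compl
  rw [probReal_compl_eq_one_sub hA, probReal_compl_eq_one_sub hA] at h2
  exact abs_le.2 ⟨by linarith, h1⟩

lemma EntropyTVBound.mono {Ω : Type*} [MeasurableSpace Ω] {P Q : Measure Ω}
    {D δ D' δ' : ℝ} (h : EntropyTVBound P Q D δ) [hne : Nonempty Ω]
    (hD : D ≤ D') (hδ : δ ≤ δ') : EntropyTVBound P Q D' δ' := by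
  intro lam g hg h0 h1
  have hl : 0 ≤ lam := (h0 hne.some).trans (h1 _)
  have := h lam g hg h0 h1
  nlinarith [mul_le_mul_of_nonneg_left hδ hl]

lemma integral_exp_sub_one {Ω : Type*} [MeasurableSpace Ω] {Q : Measure Ω}
    [IsProbabilityMeasure Q] {g : Ω → ℝ} {lam : ℝ} (hg : Measurable g) (h1 : ∀ x, g x ≤ lam) :
    ∫ x, (Real.exp (g x) - 1) ∂Q = ∫ x, Real.exp (g x) ∂Q - 1 := by
  have hi : Integrable (fun x => Real.exp (g x)) Q :=
    integrable_of_mem_Icc (lam := Real.exp lam) (Real.measurable_exp.comp hg)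
      (fun _ => (Real.exp_pos _).le) (fun _ => Real.exp_le_exp.2 (h1 _))
  rw [integral_sub hi (integrable_const _)]
  simp

/-- The relative entropy of mixtures with the same weights is controlled by the displacement of
the centres. -/
lemma entropyTVBound_gmm {π : Fin K → ℝ} (hπ : ∀ k, 0 ≤ π k) (hsum : ∑ k, π k = 1)
    {ν ν' : Fin K → 𝔼^d} {D : ℝ} (hD : ∀ k, ‖ν k - ν' k‖ ^ 2 ≤ 2 * D) :
    EntropyTVBound (gmm π ν) (gmm π ν') D 0 := by
  intro lam g hg h0 h1
  have hprob := isProbabilityMeasure_gmm hπ hsum ν'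
  have hexpm : Measurable fun x => Real.exp (g x) := Real.measurable_exp.comp hg
  rw [integral_exp_sub_one hg h1, integral_gmm hπ ν hg h0 h1,
    integral_gmm (lam := Real.exp lam) hπ ν' hexpm (fun _ => (Real.exp_pos _).le)
      (fun _ => Real.exp_le_exp.2 (h1 _))]
  have hk : ∀ k, π k * ∫ z, g (ν k + z) ∂stdGaussian 𝔼^d ≤
      π k * (∫ z, Real.exp (g (ν' k + z)) ∂stdGaussian 𝔼^d) + π k * (D - 1) := by
    intro k
    rw [← mul_add]
    refine mul_le_mul_of_nonneg_left ?_ (hπ k)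
    have h := integral_gaussian_le_log_integral_exp hg h0 h1 (ν k) (ν' k) one_pos
    simp only [one_smul] at h
    have hpos : 0 < ∫ z, Real.exp (g (ν' k + z)) ∂stdGaussian 𝔼^d := by
      refine integral_exp_pos (integrable_of_mem_Icc (lam := Real.exp lam)
        (hexpm.comp (by fun_prop : Measurable fun z : 𝔼^d => ν' k + z))
        (fun _ => (Real.exp_pos _).le) (fun _ => Real.exp_le_exp.2 (h1 _)))
    have hlog := Real.log_le_sub_one_of_pos hpos
    have := hD k
    linarith
  have := Finset.sum_le_sum fun k (_ : k ∈ Finset.univ) => hk k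
  rw [Finset.sum_add_distrib, ← Finset.sum_mul, hsum] at this
  linarith

/-- One step of the sampler started from `x`, as a function of the driving noise `z`. -/
def ddpmStep (α : ℝ) (s : 𝔼^d → 𝔼^d) (z : 𝔼^d × 𝔼^d) : 𝔼^d :=
  (1 / √α) • (z.1 + (1 - α) • s z.1) + √(1 - α) • z.2

lemma measurable_ddpmStep {α : ℝ} {s : 𝔼^d → 𝔼^d} (hs : Measurable s) :
    Measurable (ddpmStep α s) := by
  unfold ddpmStep
  fun_prop

/-- One step of the sampler against one step of the reverse process. With the exact score, a
sampler step is an Euler step for the probability flow followed by an exact Ornstein–Uhlenbeck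
step, so it errs by `e` in total variation; replacing the score by an estimate costs relative
entropy `ρ / 2` times the mean squared error. -/
lemma EntropyTVBound.step {π : Fin K → ℝ} (hπ : ∀ k, 0 < π k) (hsum : ∑ k, π k = 1)
    {ν : Fin K → 𝔼^d} {Q : Measure 𝔼^d} [IsProbabilityMeasure Q] {D δ : ℝ}
    (h : EntropyTVBound (gmm π ν) Q D δ) {s : 𝔼^d → 𝔼^d} (hs : Measurable s)
    {ρ α B e : ℝ} (hρ : 0 < ρ) (hα : α = 1 / (1 + ρ)) (hB0 : 0 ≤ B) (he0 : 0 ≤ e)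
    (hB : ∫⁻ x, ENNReal.ofReal (‖s x - (postMean π ν x - x)‖ ^ 2) ∂gmm π ν ≤ ENNReal.ofReal B)
    (he : ∫⁻ x, ENNReal.ofReal (ρ ^ 2 * (postVar π ν x ^ 2 + postVar π ν x)) ∂gmm π ν ≤
      ENNReal.ofReal e) :
    EntropyTVBound (gmm π fun k => √α • (1 + ρ) • ν k)
      ((Q.prod (stdGaussian 𝔼^d)).map (ddpmStep α s)) (D + ρ / 2 * B) (δ + e) := by
  intro lam g hg h0 h1
  have hlam : 0 ≤ lam := (h0 0).trans (h1 0)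
  have hα0 : 0 < α := by rw [hα]; positivity
  have hα1 : α < 1 := by rw [hα, div_lt_one (by positivity)]; linarith
  have hαρ : α * ρ = 1 - α := by rw [hα]; field_simp; ring
  have hσ : 0 < √(1 - α) := Real.sqrt_pos.2 (by linarith)
  have hσ2 : √(1 - α) ^ 2 = 1 - α := Real.sq_sqrt (by linarith)
  have hprob := isProbabilityMeasure_gmm (fun k => (hπ k).le) hsum ν
  have hprob' := isProbabilityMeasure_gmm (fun k => (hπ k).le) hsum (fun k => (1 + ρ) • ν k)
  have hM := (continuous_postMean hπ hsum ν).measurable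
  have hexpm : Measurable fun x => Real.exp (g x) := Real.measurable_exp.comp hg
  have hexp0 : ∀ x, 0 ≤ Real.exp (g x) := fun _ => (Real.exp_pos _).le
  have hexp1 : ∀ x, Real.exp (g x) ≤ Real.exp lam := fun _ => Real.exp_le_exp.2 (h1 _)
  have hstep := measurable_ddpmStep (α := α) hs
  have hprob2 : IsProbabilityMeasure ((Q.prod (stdGaussian 𝔼^d)).map (ddpmStep α s)) :=
    Measure.isProbabilityMeasure_map hstep.aemeasurable
  set φ : 𝔼^d → 𝔼^d := fun x => x + ρ • postMean π ν x with hφ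
  have hφm : Measurable φ := by fun_prop
  -- the exact Ornstein–Uhlenbeck average of `g`
  set H : 𝔼^d → ℝ := fun x => ∫ z, g (√α • x + √(1 - α) • z) ∂stdGaussian 𝔼^d with hH
  have hgm2 : Measurable fun w : 𝔼^d × 𝔼^d => g (√α • w.1 + √(1 - α) • w.2) :=
    hg.comp (by fun_prop)
  have hHm : Measurable H :=
    (hgm2.stronglyMeasurable.integral_prod_right (ν := stdGaussian 𝔼^d)).measurable
  have hH0 : ∀ x, 0 ≤ H x := fun x => integral_nonneg fun _ => h0 _
  have hH1 : ∀ x, H x ≤ lam := by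
    intro x
    have := integral_mono (μ := stdGaussian 𝔼^d)
      (integrable_of_mem_Icc (hgm2.comp measurable_prodMk_left) (fun _ => h0 _) (fun _ => h1 _))
      (integrable_const lam) (fun z => h1 (√α • x + √(1 - α) • z))
    simpa [hH] using this
  have hOU : ∫ x, g x ∂gmm π (fun k => √α • (1 + ρ) • ν k) =
      ∫ x, H x ∂gmm π (fun k => (1 + ρ) • ν k) := by
    rw [← map_gmm_prod_stdGaussian π (fun k => (1 + ρ) • ν k) hα0.le hα1.le,
      integral_map (by fun_prop) hg.aestronglyMeasurable, integral_prod]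
    exact integrable_of_mem_Icc hgm2 (fun _ => h0 _) (fun _ => h1 _)
  have hHφi : Integrable (fun x => H (φ x)) (gmm π ν) :=
    integrable_of_mem_Icc (hHm.comp hφm) (fun _ => hH0 _) (fun _ => hH1 _)
  -- the Euler step
  have hEuler : ∫ x, H x ∂gmm π (fun k => (1 + ρ) • ν k) ≤ ∫ x, H (φ x) ∂gmm π ν + lam * e := by
    have hm : Measurable fun x => ENNReal.ofReal (lam - H x) := by fun_prop
    have hE := lintegral_comp_add_smul_postMean_le hπ hsum ν hρ.le hm
      (lam := ENNReal.ofReal lam) (fun x => ENNReal.ofReal_le_ofReal (by linarith [hH0 x]))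
    have i1 : Integrable (fun x => lam - H x) (gmm π fun k => (1 + ρ) • ν k) :=
      (integrable_const _).sub (integrable_of_mem_Icc hHm hH0 hH1)
    have i2 : Integrable (fun x => lam - H (φ x)) (gmm π ν) :=
      (integrable_const _).sub hHφi
    have n1 : 0 ≤ ∫ x, (lam - H x) ∂gmm π fun k => (1 + ρ) • ν k :=
      integral_nonneg fun x => sub_nonneg.2 (hH1 x)
    rw [← ofReal_integral_eq_lintegral_ofReal i1
        (Filter.Eventually.of_forall fun x => sub_nonneg.2 (hH1 x)),
      ← ofReal_integral_eq_lintegral_ofReal i2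
        (Filter.Eventually.of_forall fun x => sub_nonneg.2 (hH1 _))] at hE
    have hE2 := hE.trans (add_le_add_right (mul_le_mul_right he (ENNReal.ofReal lam)) _)
    rw [← ENNReal.ofReal_mul hlam, ← ENNReal.ofReal_add n1 (by positivity),
      ENNReal.ofReal_le_ofReal_iff (by positivity),
      integral_sub (integrable_const _) (integrable_of_mem_Icc hHm hH0 hH1),
      integral_sub (integrable_const _) hHφi] at hE2
    simp only [integral_const, probReal_univ, one_smul] at hE2
    linarith
  -- the exponential average of `g` over one sampler step
  set I : 𝔼^d → ℝ := fun x => ∫ z, Real.exp (g (ddpmStep α s (x, z))) ∂stdGaussian 𝔼^d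
    with hI
  have hIm2 : Measurable fun w => Real.exp (g (ddpmStep α s w)) := hexpm.comp hstep
  have hIi : ∀ x, Integrable (fun z => Real.exp (g (ddpmStep α s (x, z))))
      (stdGaussian 𝔼^d) := fun x =>
    integrable_of_mem_Icc (hIm2.comp measurable_prodMk_left) (fun _ => hexp0 _) (fun _ => hexp1 _)
  have hIm : Measurable I :=
    (hIm2.stronglyMeasurable.integral_prod_right (ν := stdGaussian 𝔼^d)).measurable
  have hI1 : ∀ x, 1 ≤ I x := by
    intro x
    have := integral_mono (μ := stdGaussian 𝔼^d) (integrable_const 1) (hIi x)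
      (fun z => Real.one_le_exp (h0 _))
    simpa [hI] using this
  have hI2 : ∀ x, I x ≤ Real.exp lam := by
    intro x
    have := integral_mono (μ := stdGaussian 𝔼^d) (hIi x) (integrable_const (Real.exp lam))
      (fun z => hexp1 _)
    simpa [hI] using this
  have hGm : Measurable fun x => Real.log (I x) := Real.measurable_log.comp hIm
  have hG0 : ∀ x, 0 ≤ Real.log (I x) := fun x => Real.log_nonneg (hI1 x)
  have hG1 : ∀ x, Real.log (I x) ≤ lam := fun x =>
    (Real.log_le_log (by linarith [hI1 x]) (hI2 x)).trans (Real.log_exp lam).le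
  have hpt : ∀ x, H (φ x) ≤ Real.log (I x) + ρ / 2 * ‖s x - (postMean π ν x - x)‖ ^ 2 := by
    intro x
    have hDV := integral_gaussian_le_log_integral_exp hg h0 h1 (√α • φ x)
      ((1 / √α) • (x + (1 - α) • s x)) hσ
    refine hDV.trans (le_of_eq ?_)
    have hdiff : √α • φ x - (1 / √α) • (x + (1 - α) • s x) =
        (-((1 - α) / √α)) • (s x - (postMean π ν x - x)) := by
      have h3 : √α • φ x = (1 / √α) • (α • φ x) := by
        rw [smul_smul]; congr 1; field_simp; exact Real.sq_sqrt hα0.le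
      have h4 : α • φ x = x + (1 - α) • (postMean π ν x - x) := by
        rw [hφ, ← hαρ]
        simp only [smul_add, smul_smul]
        rw [hαρ]
        module
      rw [h3, h4]
      module
    rw [hdiff, norm_smul, mul_pow, hσ2, Real.norm_eq_abs, sq_abs]
    congr 1
    have : ρ = (1 - α) / α := by rw [← hαρ]; field_simp
    rw [this, neg_sq, div_pow, Real.sq_sqrt hα0.le]
    field_simp
  -- integrating over the reverse process
  have hsqm : Measurable fun x => ‖s x - (postMean π ν x - x)‖ ^ 2 := by fun_prop
  have hsqi : Integrable (fun x => ‖s x - (postMean π ν x - x)‖ ^ 2) (gmm π ν) := by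
    refine ⟨hsqm.aestronglyMeasurable, ?_⟩
    rw [hasFiniteIntegral_iff_ofReal (Filter.Eventually.of_forall fun _ => sq_nonneg _)]
    exact hB.trans_lt ENNReal.ofReal_lt_top
  have hsqB : ∫ x, ‖s x - (postMean π ν x - x)‖ ^ 2 ∂gmm π ν ≤ B := by
    rw [← ofReal_integral_eq_lintegral_ofReal hsqi
      (Filter.Eventually.of_forall fun _ => sq_nonneg _)] at hB
    exact (ENNReal.ofReal_le_ofReal_iff hB0).1 hB
  have hGi : Integrable (fun x => Real.log (I x)) (gmm π ν) := integrable_of_mem_Icc hGm hG0 hG1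
  have hint : ∫ x, H (φ x) ∂gmm π ν ≤ ∫ x, Real.log (I x) ∂gmm π ν + ρ / 2 * B := by
    have := integral_mono hHφi
      (hGi.add (hsqi.const_mul (ρ / 2))) hpt
    simp only [Pi.add_apply] at this
    rw [integral_add hGi (hsqi.const_mul (ρ / 2)), integral_const_mul] at this
    have h6 := mul_le_mul_of_nonneg_left hsqB (by positivity : 0 ≤ ρ / 2)
    linarith
  have hIH := h lam (fun x => Real.log (I x)) hGm hG0 hG1
  have hQ : ∫ x, (Real.exp (Real.log (I x)) - 1) ∂Q =
      ∫ x, (Real.exp (g x) - 1) ∂((Q.prod (stdGaussian 𝔼^d)).map (ddpmStep α s)) := by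
    rw [integral_exp_sub_one hGm hG1, integral_exp_sub_one hg h1,
      integral_map hstep.aemeasurable hexpm.aestronglyMeasurable, integral_prod _
        (integrable_of_mem_Icc hIm2 (fun _ => hexp0 _) (fun _ => hexp1 _))]
    congr 1
    exact integral_congr_ae (Filter.Eventually.of_forall fun x =>
      Real.exp_log (by linarith [hI1 x]))
  rw [hQ] at hIH
  rw [hOU]
  linarith [hEuler, hint, hIH]

/-! ### The learning rate schedule -/

section Schedule

variable {c₀ c₁ : ℝ} {T : ℕ}

lemma alphaBarRev_succ (n : ℕ) :
    alphaBarRev c₀ c₁ T (n + 1) = alphaBarRev c₀ c₁ T n *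
      (1 + c₁ * (Real.log T / T) * (1 - alphaBarRev c₀ c₁ T n)) := by
  rw [alphaBarRev]; ring

lemma alphaBarRev_mem_Ioo (hc₀ : 0 < c₀) (hT : 2 ≤ T) (hl0 : 0 ≤ c₁ * (Real.log T / T))
    (hl1 : c₁ * (Real.log T / T) ≤ 1) (n : ℕ) :
    0 < alphaBarRev c₀ c₁ T n ∧ alphaBarRev c₀ c₁ T n < 1 := by
  have hT1 : (1 : ℝ) < T := by exact_mod_cast hT
  induction n with
  | zero =>
    rw [alphaBarRev]
    have := Real.one_lt_rpow hT1 hc₀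
    exact ⟨by positivity, (div_lt_one (by positivity)).2 this⟩
  | succ n ih =>
    rw [alphaBarRev_succ]
    obtain ⟨h0, h1⟩ := ih
    set a := alphaBarRev c₀ c₁ T n
    set l := c₁ * (Real.log T / T)
    refine ⟨by positivity, ?_⟩
    have h3 : l * a < 1 := by nlinarith
    nlinarith

/-- The odds `ᾱ / (1 - ᾱ)` grow at least geometrically along the backward recursion. -/
lemma mul_one_sub_alphaBarRev_le (hc₀ : 0 < c₀) (hT : 2 ≤ T) (hl0 : 0 ≤ c₁ * (Real.log T / T))
    (hl1 : c₁ * (Real.log T / T) ≤ 1) (n : ℕ) :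
    1 / (T : ℝ) ^ c₀ * (1 + c₁ * (Real.log T / T)) ^ n * (1 - alphaBarRev c₀ c₁ T n) ≤
      alphaBarRev c₀ c₁ T n := by
  induction n with
  | zero =>
    obtain ⟨h0, h1⟩ := alphaBarRev_mem_Ioo hc₀ hT hl0 hl1 0
    rw [alphaBarRev] at h0 h1 ⊢
    nlinarith
  | succ n ih =>
    obtain ⟨h0, h1⟩ := alphaBarRev_mem_Ioo hc₀ hT hl0 hl1 n
    rw [alphaBarRev_succ]
    set a := alphaBarRev c₀ c₁ T n
    set l := c₁ * (Real.log T / T)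
    have hX : 0 ≤ 1 / (T : ℝ) ^ c₀ * (1 + l) ^ n * (1 - a) := by
      positivity
    have h2 : (1 + l) * (1 - l * a) ≤ 1 + l * (1 - a) := by nlinarith [mul_nonneg hl0 hl0]
    have h3 : 0 ≤ 1 + l * (1 - a) := by nlinarith
    calc 1 / (T : ℝ) ^ c₀ * (1 + l) ^ (n + 1) * (1 - a * (1 + l * (1 - a)))
        = 1 / (T : ℝ) ^ c₀ * (1 + l) ^ n * (1 - a) * ((1 + l) * (1 - l * a)) := by ring
      _ ≤ 1 / (T : ℝ) ^ c₀ * (1 + l) ^ n * (1 - a) * (1 + l * (1 - a)) :=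
        mul_le_mul_of_nonneg_left h2 hX
      _ ≤ a * (1 + l * (1 - a)) := mul_le_mul_of_nonneg_right ih h3

lemma alphaBar_sub {n : ℕ} (hn : n < T) :
    alphaBar c₀ c₁ T (T - n) = alphaBarRev c₀ c₁ T n := by
  rw [alphaBar, if_neg (by omega)]
  congr 1; omega

/-- After the whole schedule almost no noise is left. -/
lemma one_sub_alphaBar_one_le (hc₀ : 0 < c₀) (hc : 4 * c₀ < c₁) (hT : 4 ≤ T)
    (hl0 : 0 ≤ c₁ * (Real.log T / T)) (hl1 : c₁ * (Real.log T / T) ≤ 1 / 3) :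
    1 - alphaBar c₀ c₁ T 1 ≤ (T : ℝ) ^ (-(c₁ / 4)) := by
  have hT1 : (1 : ℝ) < T := by exact_mod_cast (by omega : 1 < T)
  have hT4 : (4 : ℝ) ≤ T := by exact_mod_cast hT
  have hT0 : (0 : ℝ) < T := by linarith
  have hlog : 0 < Real.log T := Real.log_pos hT1
  have h := mul_one_sub_alphaBarRev_le hc₀ (by omega) hl0 (by linarith) (T - 1)
  obtain ⟨h0, h1⟩ := alphaBarRev_mem_Ioo hc₀ (by omega) hl0 (by linarith) (T - 1)
  rw [show (1 : ℕ) = T - (T - 1) by omega, alphaBar_sub (by omega)]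
  set a := alphaBarRev c₀ c₁ T (T - 1)
  set l := c₁ * (Real.log T / T) with hl
  -- `1 + l ≥ exp (l / (1 + l)) ≥ exp (3 l / 4)`
  have hexp : Real.exp (3 / 4 * l) ≤ 1 + l := by
    have e1 := Real.add_one_le_exp (-(l / (1 + l)))
    have e2 : -(l / (1 + l)) + 1 = (1 + l)⁻¹ := by field_simp; ring
    rw [e2, Real.exp_neg, inv_le_inv₀ (by positivity) (Real.exp_pos _)] at e1
    refine (Real.exp_le_exp.2 ?_).trans e1
    rw [le_div_iff₀ (by positivity)]
    nlinarith
  have hpow : (T : ℝ) ^ (c₁ / 2) ≤ (1 + l) ^ (T - 1) := by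
    calc (T : ℝ) ^ (c₁ / 2) = Real.exp (Real.log T * (c₁ / 2)) := Real.rpow_def_of_pos hT0 _
      _ ≤ Real.exp (((T - 1 : ℕ) : ℝ) * (3 / 4 * l)) := by
          refine Real.exp_le_exp.2 ?_
          rw [Nat.cast_sub (by omega), Nat.cast_one]
          have hlT : l * T = c₁ * Real.log T := by rw [hl]; field_simp
          nlinarith
      _ = Real.exp (3 / 4 * l) ^ (T - 1) := Real.exp_nat_mul _ _
      _ ≤ _ := pow_le_pow_left₀ (Real.exp_pos _).le hexp _
  have hT4' : (T : ℝ) ^ (c₁ / 4) ≤ 1 / (T : ℝ) ^ c₀ * (T : ℝ) ^ (c₁ / 2) := by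
    rw [one_div, ← Real.rpow_neg hT0.le, ← Real.rpow_add hT0]
    exact Real.rpow_le_rpow_of_exponent_le hT1.le (by linarith)
  have hfin : (T : ℝ) ^ (c₁ / 4) * (1 - a) ≤ 1 := by
    refine le_trans ?_ h1.le
    refine le_trans (mul_le_mul_of_nonneg_right (hT4'.trans ?_) (by linarith)) h
    exact mul_le_mul_of_nonneg_left hpow (by positivity)
  rw [Real.rpow_neg hT0.le, ← one_div, le_div_iff₀ (by positivity)]
  linarith

lemma alphaBar_mem_Ioc (hc₀ : 0 < c₀) (hT : 2 ≤ T) (hl0 : 0 ≤ c₁ * (Real.log T / T))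
    (hl1 : c₁ * (Real.log T / T) ≤ 1) (t : ℕ) :
    0 < alphaBar c₀ c₁ T t ∧ alphaBar c₀ c₁ T t ≤ 1 := by
  unfold alphaBar
  split_ifs
  · exact ⟨one_pos, le_rfl⟩
  · have := alphaBarRev_mem_Ioo hc₀ hT hl0 hl1 (T - t)
    exact ⟨this.1, this.2.le⟩

lemma alphaBar_succ_le (hc₀ : 0 < c₀) (hT : 2 ≤ T) (hl0 : 0 ≤ c₁ * (Real.log T / T))
    (hl1 : c₁ * (Real.log T / T) ≤ 1) {t : ℕ} (ht : t < T) :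
    alphaBar c₀ c₁ T (t + 1) ≤ alphaBar c₀ c₁ T t := by
  rcases Nat.eq_zero_or_pos t with rfl | ht0
  · exact (alphaBar_mem_Ioc hc₀ hT hl0 hl1 _).2
  · unfold alphaBar
    rw [if_neg (by omega), if_neg (by omega), show T - t = T - (t + 1) + 1 by omega,
      alphaBarRev_succ]
    obtain ⟨h0, h1⟩ := alphaBarRev_mem_Ioo hc₀ hT hl0 hl1 (T - (t + 1))
    have := mul_nonneg hl0 (sub_nonneg.2 h1.le)
    nlinarith

lemma alpha_sub {n : ℕ} (hc₀ : 0 < c₀) (hT : 2 ≤ T) (hl0 : 0 ≤ c₁ * (Real.log T / T))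
    (hl1 : c₁ * (Real.log T / T) ≤ 1) (hn : n + 1 < T) :
    alpha c₀ c₁ T (T - n) =
      1 / (1 + c₁ * (Real.log T / T) * (1 - alphaBarRev c₀ c₁ T n)) := by
  have h0 := (alphaBarRev_mem_Ioo hc₀ hT hl0 hl1 n).1
  rw [alpha, show T - n - 1 = T - (n + 1) by omega, alphaBar_sub (by omega), alphaBar_sub hn,
    alphaBarRev_succ, div_mul_eq_div_div, div_self h0.ne']

/-- The forward process started from a mixture stays a mixture, with contracted centres. -/
lemma forwardLaw_gmm (hc₀ : 0 < c₀) (hT : 2 ≤ T) (hl0 : 0 ≤ c₁ * (Real.log T / T))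
    (hl1 : c₁ * (Real.log T / T) ≤ 1) (π : Fin K → ℝ) (μ : Fin K → 𝔼^d) {t : ℕ} (ht : t ≤ T) :
    forwardLaw (alpha c₀ c₁ T) (gmm π μ) t = gmm π fun k => √(alphaBar c₀ c₁ T t) • μ k := by
  induction t with
  | zero => simp [forwardLaw, alphaBar]
  | succ t ih =>
    have h0 := alphaBar_mem_Ioc hc₀ hT hl0 hl1 t
    have h1 := alphaBar_mem_Ioc hc₀ hT hl0 hl1 (t + 1)
    have h2 := alphaBar_succ_le hc₀ hT hl0 hl1 (t := t) (by omega)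
    have hα : alpha c₀ c₁ T (t + 1) = alphaBar c₀ c₁ T (t + 1) / alphaBar c₀ c₁ T t := rfl
    have hα0 : 0 ≤ alpha c₀ c₁ T (t + 1) := by
      rw [hα]; exact div_nonneg h1.1.le h0.1.le
    have hα1 : alpha c₀ c₁ T (t + 1) ≤ 1 := by
      rw [hα]; exact (div_le_one h0.1).2 h2
    rw [forwardLaw, ih (by omega), map_gmm_prod_stdGaussian π _ hα0 hα1]
    congr 1
    ext1 k
    rw [smul_smul, hα, ← Real.sqrt_mul (div_nonneg h1.1.le h0.1.le), div_mul_cancel₀ _ h0.1.ne']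

end Schedule

lemma isProbabilityMeasure_ddpmLawRev {α : ℕ → ℝ} {shat : ℕ → 𝔼^d → 𝔼^d} {T n : ℕ}
    (hs : ∀ t ∈ Finset.Icc 1 T, Measurable (shat t)) (hn : n ≤ T) :
    IsProbabilityMeasure (ddpmLawRev α shat T n) := by
  induction n with
  | zero => rw [ddpmLawRev]; infer_instance
  | succ n ih =>
    have := ih (by omega)
    exact Measure.isProbabilityMeasure_map (measurable_ddpmStep (α := α (T - n))
      (hs (T - n) (Finset.mem_Icc.2 ⟨by omega, by omega⟩))).aemeasurable

lemma gmm_zero {π : Fin K → ℝ} (hπ : ∀ k, 0 ≤ π k) (h1 : ∑ k, π k = 1) :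
    gmm π (fun _ => (0 : 𝔼^d)) = stdGaussian 𝔼^d := by
  simp only [gmm, multivariateGaussian_zero_one]
  rw [← Finset.sum_smul, ← ENNReal.ofReal_sum_of_nonneg fun k _ => hπ k, h1, ENNReal.ofReal_one,
    one_smul]

lemma tvDist_le {Ω : Type*} [MeasurableSpace Ω] {P Q : Measure Ω} {b : ℝ}
    (h : ∀ A, MeasurableSet A → |P.real A - Q.real A| ≤ b) : tvDist P Q ≤ b := by
  exact ciSup_le fun A => h A.1 A.2

lemma tvDist_le_one {Ω : Type*} [MeasurableSpace Ω] (P Q : Measure Ω) [IsProbabilityMeasure P]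
    [IsProbabilityMeasure Q] : tvDist P Q ≤ 1 :=
  tvDist_le fun _ _ => abs_sub_le_of_nonneg_of_le measureReal_nonneg measureReal_le_one
    measureReal_nonneg measureReal_le_one

lemma tvDist_eq_zero_of_subsingleton {Ω : Type*} [MeasurableSpace Ω] [Subsingleton Ω]
    (P Q : Measure Ω) [IsProbabilityMeasure P] [IsProbabilityMeasure Q] : tvDist P Q ≤ 0 :=
  tvDist_le fun A _ => by
    rcases Set.eq_empty_or_nonempty A with rfl | hA
    · simp
    · simp [Subsingleton.eq_univ_of_nonempty hA]

/-! ### Accumulation of errors along the sampler -/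

section Chain

variable {c₀ c₁ Cclip : ℝ} {T : ℕ}

/-- For truncation levels above `10 √(d log (dT))` the truncation error is of order `T⁻²`. -/
lemma clip_error_le (hd : 1 ≤ d) (hT : 2 ≤ T) {a : ℝ} (ha0 : 0 ≤ a) (ha1 : a < 1)
    (hC : 10 ≤ Cclip) :
    8 * Real.exp (-(Cclip * √(d * Real.log (d * T) / (1 - a))) ^ 2 / 32) * 2 ^ (d / 2 : ℝ) ≤
      8 / (T : ℝ) ^ 2 := by
  have hd1 : (1 : ℝ) ≤ d := by exact_mod_cast hd
  have hT2 : (2 : ℝ) ≤ T := by exact_mod_cast hT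
  have hlogT : 0 < Real.log T := Real.log_pos (by linarith)
  have hlog : Real.log T ≤ Real.log (d * T) := Real.log_le_log (by linarith) (by nlinarith)
  have hlog2 : Real.log 2 ≤ Real.log T := Real.log_le_log (by norm_num) hT2
  have hX : (d : ℝ) * Real.log T ≤ d * Real.log (d * T) / (1 - a) := by
    rw [le_div_iff₀ (by linarith)]
    have h2 : 0 ≤ (d : ℝ) * Real.log T := by positivity
    nlinarith
  have hX0 : 0 ≤ (d : ℝ) * Real.log (d * T) / (1 - a) := le_trans (by positivity) hX
  have hdl : Real.log T ≤ d * Real.log T := by nlinarith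
  have hR : 100 * (d * Real.log T) ≤ (Cclip * √(d * Real.log (d * T) / (1 - a))) ^ 2 := by
    rw [mul_pow, Real.sq_sqrt hX0]
    have : 100 ≤ Cclip ^ 2 := by nlinarith
    exact mul_le_mul this hX (by positivity) (by positivity)
  have h2 : (2 : ℝ) ^ (d / 2 : ℝ) = Real.exp (Real.log 2 * (d / 2)) :=
    Real.rpow_def_of_pos (by norm_num) _
  have h3 : 8 / (T : ℝ) ^ 2 = 8 * Real.exp (-(2 * Real.log T)) := by
    rw [Real.exp_neg, two_mul, Real.exp_add, Real.exp_log (by linarith), sq, div_eq_mul_inv]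
  rw [h3, h2, mul_assoc, ← Real.exp_add]
  refine mul_le_mul_of_nonneg_left (Real.exp_le_exp.2 ?_) (by norm_num)
  have h4 : Real.log 2 * (d / 2) ≤ d * Real.log T / 2 := by nlinarith
  linarith

/-- The sampler after `n` steps against the forward law at time `T - n`. -/
lemma entropyTVBound_ddpmLawRev (hd : 1 ≤ d) (hK : 1 ≤ K) (hc₀ : 0 < c₀) (hT : 2 ≤ T)
    (hl0 : 0 < c₁ * (Real.log T / T)) (hl1 : c₁ * (Real.log T / T) ≤ 1) (hC : 10 ≤ Cclip)
    {π : Fin K → ℝ} {μ : Fin K → 𝔼^d} (hπ : ∀ k, 0 < π k) (hsum : ∑ k, π k = 1)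
    {s : ℕ → 𝔼^d → 𝔼^d} (hs : ∀ t ∈ Finset.Icc 1 T, Measurable (s t)) {D₀ : ℝ}
    (hμ : ∀ k, ‖√(alphaBar c₀ c₁ T T) • μ k‖ ^ 2 ≤ 2 * D₀)
    (hfin : ∀ t ∈ Finset.Icc 1 T,
      scoreError (forwardLaw (alpha c₀ c₁ T) (gmm π μ) t) (s t) ≠ ∞) {n : ℕ} (hn : n < T) :
    EntropyTVBound (gmm π fun k => √(alphaBar c₀ c₁ T (T - n)) • μ k)
      (ddpmLawRev (alpha c₀ c₁ T) (clippedScore c₀ c₁ Cclip T s) T n)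
      (D₀ + ∑ i ∈ Finset.range n, c₁ * (Real.log T / T) *
        ((scoreError (forwardLaw (alpha c₀ c₁ T) (gmm π μ) (T - i)) (s (T - i))).toReal +
          8 / (T : ℝ) ^ 2))
      (n * ((c₁ * (Real.log T / T)) ^ 2 * (512 * Real.log K ^ 2 + 1025))) := by
  have hcs : ∀ t ∈ Finset.Icc 1 T, Measurable (clippedScore c₀ c₁ Cclip T s t) := fun t ht =>
    (measurable_clip _).comp (hs t ht)
  have hπ0 : ∀ k, 0 ≤ π k := fun k => (hπ k).le
  induction n with
  | zero =>
    simp only [Nat.sub_zero, Finset.range_zero, Finset.sum_empty, add_zero, ddpmLawRev,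
      Nat.cast_zero, zero_mul]
    rw [← gmm_zero hπ0 hsum]
    exact entropyTVBound_gmm hπ0 hsum fun k => by simpa using hμ k
  | succ n ih =>
    have ih := ih (by omega)
    have hmem : T - n ∈ Finset.Icc 1 T := Finset.mem_Icc.2 ⟨by omega, by omega⟩
    have hprob := isProbabilityMeasure_ddpmLawRev (α := alpha c₀ c₁ T) hcs (n := n) (by omega)
    obtain ⟨ha0, ha1⟩ := alphaBarRev_mem_Ioo hc₀ hT hl0.le hl1 n
    have hα := alpha_sub hc₀ hT hl0.le hl1 hn
    have hbar := alphaBar_sub (c₀ := c₀) (c₁ := c₁) (show n < T by omega)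
    set a := alphaBarRev c₀ c₁ T n with ha
    set l := c₁ * (Real.log T / T) with hl
    set ρ := l * (1 - a) with hρ
    have hρ0 : 0 < ρ := mul_pos hl0 (by linarith)
    have hρl : ρ ≤ l := by nlinarith
    set S := scoreError (forwardLaw (alpha c₀ c₁ T) (gmm π μ) (T - n)) (s (T - n)) with hS
    have hSfin : S ≠ ∞ := hfin _ hmem
    have hB : ∫⁻ x, ENNReal.ofReal (‖clippedScore c₀ c₁ Cclip T s (T - n) x -
        (postMean π (fun k => √(alphaBar c₀ c₁ T (T - n)) • μ k) x - x)‖ ^ 2)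
          ∂gmm π (fun k => √(alphaBar c₀ c₁ T (T - n)) • μ k) ≤
        ENNReal.ofReal (S.toReal + 8 / (T : ℝ) ^ 2) := by
      have h := lintegral_clip_sub_score_le hπ hsum
        (fun k => √(alphaBar c₀ c₁ T (T - n)) • μ k)
        (R := Cclip * √(d * Real.log (d * T) / (1 - alphaBar c₀ c₁ T (T - n))))
        (by positivity) (s (T - n))
      refine h.trans ?_
      rw [ENNReal.ofReal_add ENNReal.toReal_nonneg (by positivity), ENNReal.ofReal_toReal hSfin,
        hS, forwardLaw_gmm hc₀ hT hl0.le hl1 π μ (show T - n ≤ T by omega), hbar]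
      gcongr
      exact clip_error_le hd hT ha0.le ha1 hC
    have hstep := ih.step hπ hsum (hcs _ hmem) hρ0 hα
      (add_nonneg ENNReal.toReal_nonneg (by positivity)) (by positivity) hB
      (lintegral_euler_error_le hπ hsum _ hK ρ)
    have hnu : (fun k => √(alpha c₀ c₁ T (T - n)) • (1 + ρ) •
        √(alphaBar c₀ c₁ T (T - n)) • μ k) =
        fun k => √(alphaBar c₀ c₁ T (T - (n + 1))) • μ k := by
      ext1 k
      rw [smul_smul, smul_smul, hα, hbar, alphaBar_sub hn, alphaBarRev_succ, ← hl, ← ha, ← hρ]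
      congr 1
      have h1ρ : (1 + ρ) = √(1 + ρ) * √(1 + ρ) := (Real.mul_self_sqrt (by positivity)).symm
      rw [Real.sqrt_mul ha0.le, Real.sqrt_div zero_le_one, Real.sqrt_one]
      nth_rewrite 2 [h1ρ]
      field_simp
    rw [hnu] at hstep
    refine hstep.mono ?_ ?_
    · rw [Finset.sum_range_succ]
      have h5 : 0 ≤ S.toReal + 8 / (T : ℝ) ^ 2 :=
        add_nonneg ENNReal.toReal_nonneg (by positivity)
      have h6 : ρ / 2 * (S.toReal + 8 / (T : ℝ) ^ 2) ≤ l * (S.toReal + 8 / (T : ℝ) ^ 2) :=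
        mul_le_mul_of_nonneg_right (by linarith) h5
      linarith
    · push_cast
      have h7 : ρ ^ 2 ≤ l ^ 2 := pow_le_pow_left₀ hρ0.le hρl 2
      have h8 : ρ ^ 2 * (512 * Real.log K ^ 2 + 1025) ≤ l ^ 2 * (512 * Real.log K ^ 2 + 1025) :=
        mul_le_mul_of_nonneg_right h7 (by positivity)
      linarith

end Chain

/-! ### The total variation bound -/

/-- The total score error along the times visited by the sampler, from the averaged bound. -/
lemma sum_toReal_le_of_sum_div_le {T : ℕ} (hT : 1 ≤ T) {S : ℕ → ℝ≥0∞} {b : ℝ} (hb : 0 ≤ b)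
    (h : (∑ t ∈ Finset.Icc 1 T, S t) / (T : ℝ≥0∞) ≤ ENNReal.ofReal b) :
    (∀ t ∈ Finset.Icc 1 T, S t ≠ ∞) ∧
      ∑ i ∈ Finset.range (T - 1), (S (T - i)).toReal ≤ T * b := by
  have hT0 : (T : ℝ≥0∞) ≠ 0 := by simp; omega
  rw [ENNReal.div_le_iff hT0 (by simp)] at h
  have hlt : ∑ t ∈ Finset.Icc 1 T, S t < ∞ :=
    h.trans_lt (ENNReal.mul_lt_top ENNReal.ofReal_lt_top (by simp))
  have hfin : ∀ t ∈ Finset.Icc 1 T, S t ≠ ∞ := fun t ht => (ENNReal.sum_lt_top.1 hlt t ht).ne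
  refine ⟨hfin, ?_⟩
  have h1 : ∑ t ∈ Finset.Icc 1 T, (S t).toReal ≤ T * b := by
    rw [← ENNReal.toReal_sum hfin]
    refine ENNReal.toReal_le_of_le_ofReal (by positivity) (h.trans (le_of_eq ?_))
    rw [mul_comm, ENNReal.ofReal_mul (by positivity), ENNReal.ofReal_natCast]
  refine le_trans ?_ h1
  rw [← Finset.sum_image (s := Finset.range (T - 1)) (g := fun i => T - i)
    (f := fun t => (S t).toReal)]
  · refine Finset.sum_le_sum_of_subset_of_nonneg (fun t ht => ?_)
      fun _ _ _ => ENNReal.toReal_nonneg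
    obtain ⟨i, hi, rfl⟩ := Finset.mem_image.1 ht
    rw [Finset.mem_range] at hi
    exact Finset.mem_Icc.2 ⟨by omega, by omega⟩
  · intro i hi j hj hij
    simp only [Finset.coe_range, Set.mem_Iio] at hi hj
    simp only [] at hij
    omega

/-- Each error term is dominated by `A² B² / T + ε √B`, where `A = log (K T)`, `B = log T` and
`L = log K`. -/
lemma error_terms_le {A B L T q c ε : ℝ} (hT : 0 < T) (hB : 1 / 2 ≤ B) (hAB : B ≤ A) (hL : 0 ≤ L)
    (hLA : L ≤ A) (hq : 0 ≤ q) (hε : 0 ≤ ε) :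
    4 / T + 2 * q * √B * (ε + 3 / T) + c ^ 2 * B ^ 2 / T * (512 * L ^ 2 + 1025) ≤
      (64 + 96 * q + 4612 * c ^ 2 + 2 * q) * (A ^ 2 * B ^ 2 / T + ε * √B) := by
  have hA2 : 1 / 4 ≤ A ^ 2 := by nlinarith
  have hL2 : L ^ 2 ≤ A ^ 2 := pow_le_pow_left₀ hL hLA 2
  have hBq : 1 / 4 * B ^ 2 ≤ A ^ 2 * B ^ 2 := mul_le_mul_of_nonneg_right hA2 (sq_nonneg B)
  have hB2 : 1 / 2 * B ≤ B ^ 2 := by nlinarith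
  have hsB : √B ≤ 2 * B := Real.sqrt_le_iff.2 ⟨by linarith, by nlinarith⟩
  have b1 : 4 / T ≤ 64 * (A ^ 2 * B ^ 2 / T) := by
    rw [← mul_div_assoc]
    exact div_le_div_of_nonneg_right (by linarith) hT.le
  have b2 : √B / T ≤ 16 * (A ^ 2 * B ^ 2 / T) := by
    rw [← mul_div_assoc]
    exact div_le_div_of_nonneg_right (by linarith) hT.le
  have b3 : c ^ 2 * B ^ 2 / T * (512 * L ^ 2 + 1025) ≤ 4612 * c ^ 2 * (A ^ 2 * B ^ 2 / T) := by
    calc c ^ 2 * B ^ 2 / T * (512 * L ^ 2 + 1025)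
        ≤ c ^ 2 * B ^ 2 / T * (4612 * A ^ 2) :=
          mul_le_mul_of_nonneg_left (by linarith) (by positivity)
      _ = 4612 * c ^ 2 * (A ^ 2 * B ^ 2 / T) := by ring
  have b4 : 2 * q * √B * (ε + 3 / T) = 2 * q * (ε * √B) + 6 * q * (√B / T) := by ring
  have b5 : 6 * q * (√B / T) ≤ 6 * q * (16 * (A ^ 2 * B ^ 2 / T)) :=
    mul_le_mul_of_nonneg_left b2 (by positivity)
  have b6 : 0 ≤ 2 * q * (A ^ 2 * B ^ 2 / T) := by positivity
  have b7 : 0 ≤ (64 + 96 * q + 4612 * c ^ 2) * (ε * √B) := by positivity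
  rw [b4]
  refine (add_le_add (add_le_add b1 (add_le_add_right b5 _)) b3).trans ?_
  refine (le_add_of_nonneg_right (add_nonneg b6 b7)).trans (le_of_eq ?_)
  ring

/-- The bound on the sampler for a number of steps that is large in terms of `c₁`. -/
lemma tvDist_ddpmOutputLaw_le {cR c₀ c₁ Cclip : ℝ} (hcR : 0 < cR) (hc₀ : 4 * cR + 4 ≤ c₀)
    (hc : 4 * c₀ < c₁) (hC : 10 ≤ Cclip) {T : ℕ} (hd : 1 ≤ d) (hK : 1 ≤ K) (hT : 4 ≤ T)
    (hl1 : c₁ * (Real.log T / T) ≤ 1 / 3) {π : Fin K → ℝ} {μ : Fin K → 𝔼^d} (hπ : ∀ k, 0 < π k)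
    (hsum : ∑ k, π k = 1) (hμ : ∀ k, ‖μ k‖ ≤ (T : ℝ) ^ cR) {s : ℕ → 𝔼^d → 𝔼^d} {ε : ℝ}
    (hs : ∀ t ∈ Finset.Icc 1 T, Measurable (s t)) (hε : 0 ≤ ε)
    (hscore : (∑ t ∈ Finset.Icc 1 T,
      scoreError (forwardLaw (alpha c₀ c₁ T) (gmm π μ) t) (s t)) / (T : ℝ≥0∞)
        ≤ ENNReal.ofReal (ε ^ 2)) :
    tvDist (gmm π μ) (ddpmOutputLaw c₀ c₁ Cclip T s) ≤
      4 / T + 2 * √c₁ * √(Real.log T) * (ε + 3 / T) +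
        c₁ ^ 2 * Real.log T ^ 2 / T * (512 * Real.log K ^ 2 + 1025) := by
  have hT1 : (1 : ℝ) < T := by exact_mod_cast (by omega : 1 < T)
  have hT0 : (0 : ℝ) < T := by linarith
  have hlog : 0 < Real.log T := Real.log_pos hT1
  have hc₁ : 0 < c₁ := by linarith
  have hc₀' : 0 < c₀ := by linarith
  have hl0 : 0 < c₁ * (Real.log T / T) := by positivity
  have hπ0 : ∀ k, 0 ≤ π k := fun k => (hπ k).le
  have hTinv : (T : ℝ) ^ (-1 : ℝ) = 1 / T := by rw [Real.rpow_neg_one, one_div]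
  -- the prior of the sampler is close to the law at time `T`
  have hprior : ∀ k, ‖√(alphaBar c₀ c₁ T T) • μ k‖ ^ 2 ≤ 2 * (1 / (T : ℝ) ^ 2) := by
    intro k
    have h0 : alphaBar c₀ c₁ T T = (T : ℝ) ^ (-c₀) := by
      rw [alphaBar, if_neg (by omega), Nat.sub_self, alphaBarRev, Real.rpow_neg hT0.le, one_div]
    rw [norm_smul, Real.norm_of_nonneg (Real.sqrt_nonneg _), mul_pow, h0,
      Real.sq_sqrt (Real.rpow_nonneg hT0.le _)]
    have h2 : ‖μ k‖ ^ 2 ≤ (T : ℝ) ^ (2 * cR) := by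
      rw [two_mul, Real.rpow_add hT0, ← sq]
      exact pow_le_pow_left₀ (norm_nonneg _) (hμ k) 2
    calc (T : ℝ) ^ (-c₀) * ‖μ k‖ ^ 2 ≤ (T : ℝ) ^ (-c₀) * (T : ℝ) ^ (2 * cR) :=
          mul_le_mul_of_nonneg_left h2 (Real.rpow_nonneg hT0.le _)
      _ = (T : ℝ) ^ (-c₀ + 2 * cR) := (Real.rpow_add hT0 _ _).symm
      _ ≤ (T : ℝ) ^ (-2 : ℝ) := Real.rpow_le_rpow_of_exponent_le hT1.le (by linarith)
      _ = 1 / (T : ℝ) ^ 2 := by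
          rw [Real.rpow_neg hT0.le, one_div]; norm_num
      _ ≤ 2 * (1 / (T : ℝ) ^ 2) := by
          have : 0 < 1 / (T : ℝ) ^ 2 := by positivity
          linarith
  -- the target is close to the law at time `1`
  have hone : EntropyTVBound (gmm π μ) (gmm π fun k => √(alphaBar c₀ c₁ T 1) • μ k)
      (1 / (T : ℝ) ^ 2) 0 := by
    refine entropyTVBound_gmm hπ0 hsum fun k => ?_
    have ha := alphaBar_mem_Ioc hc₀' (by omega) hl0.le (by linarith) (T := T) 1
    have hb := one_sub_alphaBar_one_le hc₀' hc hT hl0.le hl1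
    set a := alphaBar c₀ c₁ T 1
    have hsa : a ≤ √a := by
      refine (Real.le_sqrt' ha.1).2 ?_
      nlinarith [ha.1, ha.2]
    have hsa1 : √a ≤ 1 := Real.sqrt_le_one.2 ha.2
    have h1 : ‖μ k - √a • μ k‖ ≤ 1 / T := by
      have h3 : μ k - √a • μ k = (1 - √a) • μ k := by rw [sub_smul, one_smul]
      rw [h3, norm_smul, Real.norm_of_nonneg (by linarith)]
      calc (1 - √a) * ‖μ k‖ ≤ (T : ℝ) ^ (-(c₁ / 4)) * (T : ℝ) ^ cR :=
            mul_le_mul (by linarith) (hμ k) (norm_nonneg _) (Real.rpow_nonneg hT0.le _)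
        _ = (T : ℝ) ^ (-(c₁ / 4) + cR) := (Real.rpow_add hT0 _ _).symm
        _ ≤ (T : ℝ) ^ (-1 : ℝ) := Real.rpow_le_rpow_of_exponent_le hT1.le (by linarith)
        _ = 1 / T := hTinv
    have h2 := pow_le_pow_left₀ (norm_nonneg _) h1 2
    rw [div_pow, one_pow] at h2
    have : 0 < 1 / (T : ℝ) ^ 2 := by positivity
    linarith
  -- the sampler tracks the reverse process from time `T` to time `1`
  obtain ⟨hfin, hS⟩ := sum_toReal_le_of_sum_div_le (by omega) (sq_nonneg ε) hscore
  have hchain := entropyTVBound_ddpmLawRev hd hK hc₀' (by omega) hl0 (by linarith) hC hπ hsum hs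
    hprior hfin (show T - 1 < T by omega)
  rw [show T - (T - 1) = 1 by omega] at hchain
  have hchain := hchain.mono (D' := 1 / (T : ℝ) ^ 2 + c₁ * Real.log T * (ε ^ 2 + 8 / (T : ℝ) ^ 2))
    (δ' := c₁ ^ 2 * Real.log T ^ 2 / T * (512 * Real.log K ^ 2 + 1025)) (by
      rw [← Finset.mul_sum, Finset.sum_add_distrib, Finset.sum_const, Finset.card_range,
        nsmul_eq_mul]
      have hTT : ((T - 1 : ℕ) : ℝ) ≤ T := by exact_mod_cast Nat.sub_le T 1
      have h1 : ((T - 1 : ℕ) : ℝ) * (8 / (T : ℝ) ^ 2) ≤ T * (8 / (T : ℝ) ^ 2) :=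
        mul_le_mul_of_nonneg_right hTT (by positivity)
      have h2 := mul_le_mul_of_nonneg_left (add_le_add hS h1) hl0.le
      have h3 : c₁ * (Real.log T / T) * (T * ε ^ 2 + T * (8 / (T : ℝ) ^ 2)) =
          c₁ * Real.log T * (ε ^ 2 + 8 / (T : ℝ) ^ 2) := by field_simp
      linarith) (by
      have hTT : ((T - 1 : ℕ) : ℝ) ≤ T := by exact_mod_cast Nat.sub_le T 1
      refine (mul_le_mul_of_nonneg_right hTT (by positivity)).trans (le_of_eq ?_)
      field_simp)
  have hcs : ∀ t ∈ Finset.Icc 1 T, Measurable (clippedScore c₀ c₁ Cclip T s t) := fun t ht =>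
    (measurable_clip _).comp (hs t ht)
  have p0 := isProbabilityMeasure_gmm hπ0 hsum μ
  have p1 := isProbabilityMeasure_gmm hπ0 hsum fun k => √(alphaBar c₀ c₁ T 1) • μ k
  have p2 := isProbabilityMeasure_ddpmLawRev (α := alpha c₀ c₁ T) hcs (n := T - 1) (by omega)
  refine tvDist_le fun A hA => ?_
  have t1 := hone.abs_measureReal_sub_le (by positivity) le_rfl hA
  have t2 := hchain.abs_measureReal_sub_le (by positivity) (by positivity) hA
  have t3 := abs_sub_le ((gmm π μ).real A)
    ((gmm π fun k => √(alphaBar c₀ c₁ T 1) • μ k).real A)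
    ((ddpmLawRev (alpha c₀ c₁ T) (clippedScore c₀ c₁ Cclip T s) T (T - 1)).real A)
  have hs1 : √(1 / (T : ℝ) ^ 2) = 1 / T := by
    rw [← one_div_pow, Real.sqrt_sq (by positivity)]
  have hs2 : √(1 / (T : ℝ) ^ 2 + c₁ * Real.log T * (ε ^ 2 + 8 / (T : ℝ) ^ 2)) ≤
      1 / T + √c₁ * √(Real.log T) * (ε + 3 / T) := by
    refine Real.sqrt_le_iff.2 ⟨by positivity, ?_⟩
    have q1 : (√c₁ * √(Real.log T)) ^ 2 = c₁ * Real.log T := by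
      rw [mul_pow, Real.sq_sqrt hc₁.le, Real.sq_sqrt hlog.le]
    set q := √c₁ * √(Real.log T)
    have q0 : 0 ≤ q := by positivity
    rw [← q1]
    have e8 : 8 / (T : ℝ) ^ 2 ≤ (3 / T) ^ 2 := by
      rw [div_pow]; gcongr; norm_num
    have e9 : ε ^ 2 + 8 / (T : ℝ) ^ 2 ≤ (ε + 3 / T) ^ 2 := by
      have e0 : 0 ≤ 2 * ε * (3 / T) := by positivity
      rw [add_sq]
      linarith
    have e10 := mul_le_mul_of_nonneg_left e9 (sq_nonneg q)
    have e11 : 0 ≤ 2 * (1 / (T : ℝ)) * (q * (ε + 3 / T)) := by positivity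
    rw [add_sq, one_div_pow, mul_pow]
    linarith
  rw [hs1] at t1
  have e4 : 4 / (T : ℝ) = 2 * (1 / T) + 2 * (1 / T) := by ring
  rw [ddpmOutputLaw, e4]
  linarith

end

theorem mainTheorem2 :
    ∃ Cclip₀ : ℝ, 0 < Cclip₀ ∧
    ∀ cR : ℝ, 0 < cR →
    ∃ cmin : ℝ, 0 < cmin ∧
    ∀ c₀ c₁ Cclip : ℝ, cmin ≤ c₀ → cmin ≤ c₁ → 4 < c₁ / c₀ → Cclip₀ ≤ Cclip →
    ∃ C : ℝ, 0 < C ∧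
    ∀ (d K T : ℕ), 2 ≤ T →
    ∀ (π : Fin K → ℝ) (μ : Fin K → EuclideanSpace ℝ (Fin d)),
      (∀ k, 0 < π k) → ∑ k, π k = 1 → (∀ k, ‖μ k‖ ≤ (T : ℝ) ^ cR) →
    ∀ (s : ℕ → EuclideanSpace ℝ (Fin d) → EuclideanSpace ℝ (Fin d)) (εscore : ℝ),
      (∀ t ∈ Finset.Icc 1 T, Measurable (s t)) →
      0 ≤ εscore →
      (∑ t ∈ Finset.Icc 1 T,
          scoreError (forwardLaw (alpha c₀ c₁ T) (gmm π μ) t) (s t)) / (T : ℝ≥0∞)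
        ≤ ENNReal.ofReal (εscore ^ 2) →
      tvDist (gmm π μ) (ddpmOutputLaw c₀ c₁ Cclip T s) ≤
        C * (Real.log (K * T) ^ 2 * Real.log T ^ 2 / T + εscore * √(Real.log T)) := by
  -- level `10` makes the truncation error `O(T⁻²)`; `4 cR + 4` makes both `T^{2 cR - c₀}` and
  -- `T^{cR - c₁ / 4}` small enough to absorb the norms of the centres
  refine ⟨10, by norm_num, fun cR hcR => ⟨4 * cR + 4, by positivity, ?_⟩⟩
  intro c₀ c₁ Cclip hc₀ hcmin₁ hratio hC
  have hc₀' : 0 < c₀ := by linarith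
  have hc : 4 * c₀ < c₁ := (lt_div_iff₀ hc₀').1 hratio
  have hc₁ : 0 < c₁ := by linarith
  -- beyond `T₀` steps the schedule behaves as intended
  obtain ⟨T₀, hT₀⟩ : ∃ T₀ : ℕ, ∀ T : ℕ, T₀ ≤ T → c₁ * (Real.log T / T) ≤ 1 / 3 := by
    have h := (Real.isLittleO_log_id_atTop.tendsto_div_nhds_zero.comp
      tendsto_natCast_atTop_atTop).const_mul c₁
    rw [mul_zero] at h
    exact Filter.eventually_atTop.1 (h.eventually (ge_mem_nhds (by norm_num)))
  refine ⟨16 * (T₀ + 4) + 64 + 96 * √c₁ + 4612 * c₁ ^ 2 + 2 * √c₁, by positivity, ?_⟩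
  intro d K T hT π μ hπ hsum hμ s ε hs hε hscore
  have hK : 1 ≤ K := by
    by_contra hK
    obtain rfl : K = 0 := by omega
    rw [Finset.univ_eq_empty, Finset.sum_empty] at hsum
    exact zero_ne_one hsum
  have hπ0 : ∀ k, 0 ≤ π k := fun k => (hπ k).le
  have hT2 : (2 : ℝ) ≤ T := by exact_mod_cast hT
  have hT0 : (0 : ℝ) < T := by linarith
  have hK1 : (1 : ℝ) ≤ K := by exact_mod_cast hK
  have hcs : ∀ t ∈ Finset.Icc 1 T, Measurable (clippedScore c₀ c₁ Cclip T s t) := fun t ht =>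
    (measurable_clip _).comp (hs t ht)
  have p0 := isProbabilityMeasure_gmm hπ0 hsum μ
  have p1 : IsProbabilityMeasure (ddpmOutputLaw c₀ c₁ Cclip T s) :=
    isProbabilityMeasure_ddpmLawRev (α := alpha c₀ c₁ T) hcs (n := T - 1) (by omega)
  set B := Real.log T with hB
  set A := Real.log (K * T) with hA
  have hB2 : 1 / 2 ≤ B := by
    have := Real.log_le_log (by norm_num) hT2
    linarith [Real.log_two_gt_d9]
  have hAB : B ≤ A := Real.log_le_log hT0 (by nlinarith)
  have hKA : Real.log K ≤ A := Real.log_le_log (by linarith) (by nlinarith)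
  have hK0 : 0 ≤ Real.log K := Real.log_nonneg hK1
  have hA2 : 1 / 4 ≤ A ^ 2 := by nlinarith
  set m := A ^ 2 * B ^ 2 / T with hm
  have hm0 : 0 ≤ m := by positivity
  rcases Nat.eq_zero_or_pos d with rfl | hd
  · refine (tvDist_eq_zero_of_subsingleton _ _).trans ?_
    positivity
  rcases lt_or_ge T (T₀ + 4) with hsmall | hlarge
  · refine (tvDist_le_one _ _).trans ?_
    have h1 : 1 ≤ 16 * ((T₀ : ℝ) + 4) * m := by
      have h2 : (T : ℝ) ≤ T₀ + 4 := by exact_mod_cast hsmall.le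
      rw [hm, ← mul_div_assoc, le_div_iff₀ hT0]
      have hB4 : 1 / 4 ≤ B ^ 2 := by nlinarith
      have h3 : 1 / 16 ≤ A ^ 2 * B ^ 2 :=
        le_trans (by norm_num) (mul_le_mul hA2 hB4 (by norm_num) (sq_nonneg A))
      have h4 := mul_le_mul_of_nonneg_left h3 (by positivity : 0 ≤ 16 * ((T₀ : ℝ) + 4))
      linarith
    refine h1.trans (mul_le_mul ?_ (le_add_of_nonneg_right (by positivity)) hm0 (by positivity))
    have h5 : 0 ≤ 64 + 96 * √c₁ + 4612 * c₁ ^ 2 + 2 * √c₁ := by positivity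
    linarith
  · have hbound := tvDist_ddpmOutputLaw_le hcR hc₀ hc hC hd hK (by omega) (hT₀ T (by omega))
      hπ hsum hμ hs hε hscore
    refine hbound.trans ?_
    rw [← hB]
    have harith := error_terms_le (c := c₁) hT0 hB2 hAB hK0 hKA (Real.sqrt_nonneg c₁) hε
    have hsum0 : 0 ≤ 16 * ((T₀ : ℝ) + 4) * (m + ε * √B) := by positivity
    refine harith.trans ((le_add_of_nonneg_left hsum0).trans (le_of_eq ?_))
    rw [← add_mul]
    congr 1
    ring
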